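/- **Setting.** Let the operation be either rank (data in $[0,1]$, queries $x\in[0,1]$, and $f_D(x)$ is the number of points of $D$ that are smaller than $x$) or cardinality (data in $[0,1]^d$, queries $x=(c,r)\in[0,1]^{2d}$, and $f_D(x)$ is the number of points of $D$ in $\prod_i[c_i,c_i+r_i]$). For probability distributions $\chi=(\chi_1,\dots,\chi_n)$ write $D\sim\chi$ if $D=(D_1,\dots,D_n)$ with independent $D_i\sim\chi_i$, and let $f_\chi(x)=\mathbb E_{D\sim\chi}[f_D(x)]$. All norms are supremum norms over the queries. Operations are counted on a random access machine over the reals (unit-cost arithmetic, floor, comparison, indirect addressing, reading an input coordinate). *Model class.* $\mathcal F=(\mathcal F_\vartheta)$ is a class of models with a (preordered) hyperparameter $\vartheta$: a model in $\mathcal F_\vartheta$ is a finite list of parameters from a prescribed set, which the inference program of $\vartheta$ evaluates at each query. Let $\tau(\vartheta)$ be the maximum number of operations of an evaluation of a model in $\mathcal F_\vartheta$, and $\sigma(\vartheta)$ the maximum space needed to store a model in $\mathcal F_\vartheta$ (number of its parameters plus size of the inference program). *Representation power.* $\mathcal F$ has enough representation power for a set $\mathcal G$ of functions of the query if there is a function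 $\alpha$ such that, for every $\epsilon>0$, $\alpha(\epsilon)$ is the smallest $\vartheta$ for which every $g\in\mathcal G$ has some $f\in\mathcal F_\vartheta$ with $\|f-g\|_\infty\le\epsilon$. Put $\tau_{\mathcal F\to\mathcal G}(\epsilon)=\tau(\alpha(\epsilon))$ and $\sigma_{\mathcal F\to\mathcal G}(\epsilon)=\sigma(\alpha(\epsilon))$. *Optimizability.* $\mathcal F$ is (approximately) optimizable by an algorithm $\mathcal A$ with constants $0<\varkappa\le1$ and $\varkappa'\ge0$ if for all $n\ge1$, every $h=\frac1nf_D$ with $D$ a data set of size $n$, and every $\vartheta$, $\mathcal A(h,\vartheta)$ halts and returns a model of some $\hat h\in\mathcal F_\vartheta$ with $$\|\hat h-h\|_\infty\le\tfrac1\varkappa\,\|f-h\|_\infty+\tfrac{\varkappa'}{\sqrt n}\qquad\text{for all } f\in\mathcal F_\vartheta .$$ Here $\mathcal A$ can evaluate $h$ at any query at the cost of one operation, and may also read $D$. Let $\beta_n(\vartheta)$ be the maximum number of operations of $\mathcal A(\frac1nf_D,\vartheta)$ over the data sets $D$ of size $n$ (so $\beta_n(\vartheta)\le\beta(\vartheta)$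 if $\beta(\vartheta)$ bounds the running time of $\mathcal A$ on all functions). *Distribution learnability.* A distribution class $\mathfrak X$ is distribution learnable with parameters $T_n,S_n,B_n$ (possibly infinite) and constants $\varkappa_1,\varkappa_2>0$ if for every $n\ge1$ there is an algorithm that, given any data set $D$ of $n$ records (and nothing else), returns after at most $nB_n$ operations (that is, $B_n$ amortized) a model $\hat f$ that can be evaluated at any query in at most $T_n$ operations and stored in space at most $S_n$, and such that for all $\chi=(\chi_1,\dots,\chi_n)$ with $\chi_i\in\mathfrak X$ and all $\epsilon\ge\sqrt n$, $$\mathbb P_{D\sim\chi}\big[\|f_\chi-\hat f\|_\infty\ge\epsilon\big]\le\varkappa_1e^{-\varkappa_2\left(\frac{\epsilon}{\sqrt n}-1\right)^2}.$$ It is distribution learnable from i.i.d. data if this holds with the bound required only for $\chi_1=\dots=\chi_n\in\mathfrak X$. **Theorem.** For each of the operations there is a constant $C$, and for all $0<\varkappa\le1$ and $\varkappa'\ge0$ there are constants $\varkappa_1,\varkappa_2>0$ (depending only on the operation, hence on $d$, and on $\varkappa,\varkappa'$), such that the following holds. Let $\mathcal F$ have enough representation power for $\mathcal G$, with representation complexity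 function $\alpha$, let $\mathcal F$ be (approximately) optimizable by $\mathcal A$ with constants $\varkappa,\varkappa'$, and let $\mathfrak X$ be a distribution class. 1. If $\frac1nf_\chi\in\mathcal G$ for all $n\ge1$ and all $\chi=(\chi_1,\dots,\chi_n)$ with $\chi_i\in\mathfrak X$, then $\mathfrak X$ is distribution learnable with constants $\varkappa_1,\varkappa_2$ and, up to the constant factor $C$, $$T_n=\tau_{\mathcal F\to\mathcal G}\big(\tfrac1{\sqrt n}\big),\qquad S_n=\sigma_{\mathcal F\to\mathcal G}\big(\tfrac1{\sqrt n}\big),\qquad B_n=\beta_n\big(\alpha(\tfrac1{\sqrt n})\big).$$ 2. If only $f_\chi\in\mathcal G$ for every single distribution $\chi\in\mathfrak X$ (the operation function of one record), then $\mathfrak X$ is distribution learnable from i.i.d. data with the same constants and parameters. -/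

import Mathlib

open MeasureTheory
open scoped ENNReal unitInterval

namespace LearnedDB

/-! ### The machine: a random access machine over the reals with a step count -/

/-- Instructions. `L` are the labels, `R` the registers, `w` is the width of an input record and
`k` the arity of the oracle. Every instruction is one operation. -/
inductive Instr (L R : Type) (w k : ℕ) : Type
  /-- `dst := a` -/
  | const (dst : R) (a : ℝ) (next : L)
  /-- `dst := a + b` -/
  | add (dst a b : R) (next : L)
  /-- `dst := a - b` -/
  | sub (dst a b : R) (next : L)
  /-- `dst := a * b` -/
  | mul (dst a b : R) (next : L)
  /-- `dst := a / b` (and `0` if `b = 0`) -/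
  | div (dst a b : R) (next : L)
  /-- `dst := ⌊a⌋` -/
  | floor (dst a : R) (next : L)
  /-- go to `yes` if `a < b`, to `no` otherwise -/
  | branchLt (a b : R) (yes no : L)
  /-- `dst := mem[⌊addr⌋]` -/
  | load (dst addr : R) (next : L)
  /-- `mem[⌊addr⌋] := src` -/
  | store (addr src : R) (next : L)
  /-- `dst :=` the number of input records -/
  | size (dst : R) (next : L)
  /-- `dst :=` column `col` of the input record number `⌊row⌋` -/
  | input (dst row : R) (col : Fin w) (next : L)
  /-- `dst :=` the answer of the oracle to the arguments `args` -/
  | query (dst : R) (args : Fin k → R) (next : L)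
  | halt

/-- A program: finitely many labelled instructions that use finitely many registers. -/
structure Program (w k : ℕ) : Type 1 where
  L : Type
  R : Type
  finL : Finite L
  finR : Finite R
  start : L
  out : R
  code : L → Instr L R w k

/-- What a program is run on: read-only input records (numbered from `0`) and an oracle, which
gives no answer outside its domain. -/
structure Env (w k : ℕ) where
  size : ℕ
  input : ℕ → Fin w → ℝ
  oracle : (Fin k → ℝ) → Option ℝ

/-- A configuration: the current label, the registers and the memory. -/
structure Config (L R : Type) where
  label : L
  reg : R → ℝ
  mem : ℕ → ℝ

namespace Program

variable {w k : ℕ}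

/-- The number of instructions and registers. -/
noncomputable def size (P : Program w k) : ℕ := Nat.card P.L + Nat.card P.R

open Classical in
/-- One step. There is no next configuration after `halt`, nor when the oracle does not answer. -/
noncomputable def step (P : Program w k) (E : Env w k) (c : Config P.L P.R) :
    Option (Config P.L P.R) :=
  match P.code c.label with
  | .const dst a l => some ⟨l, Function.update c.reg dst a, c.mem⟩
  | .add dst a b l => some ⟨l, Function.update c.reg dst (c.reg a + c.reg b), c.mem⟩
  | .sub dst a b l => some ⟨l, Function.update c.reg dst (c.reg a - c.reg b), c.mem⟩
  | .mul dst a b l => some ⟨l, Function.update c.reg dst (c.reg a * c.reg b), c.mem⟩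
  | .div dst a b l => some ⟨l, Function.update c.reg dst (c.reg a / c.reg b), c.mem⟩
  | .floor dst a l => some ⟨l, Function.update c.reg dst (⌊c.reg a⌋ : ℝ), c.mem⟩
  | .branchLt a b yes no => some ⟨if c.reg a < c.reg b then yes else no, c.reg, c.mem⟩
  | .load dst addr l => some ⟨l, Function.update c.reg dst (c.mem ⌊c.reg addr⌋₊), c.mem⟩
  | .store addr src l => some ⟨l, c.reg, Function.update c.mem ⌊c.reg addr⌋₊ (c.reg src)⟩
  | .size dst l => some ⟨l, Function.update c.reg dst (E.size : ℝ), c.mem⟩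
  | .input dst row col l =>
      some ⟨l, Function.update c.reg dst (E.input ⌊c.reg row⌋₊ col), c.mem⟩
  | .query dst args l =>
      (E.oracle fun j => c.reg (args j)).map fun y => ⟨l, Function.update c.reg dst y, c.mem⟩
  | .halt => none

/-- Started with all registers `0` and the memory `m₀`, the program executes exactly `t`
instructions, the last of which is `halt`, and stops in the configuration `c`. -/
def HaltsWith (P : Program w k) (E : Env w k) (m₀ : ℕ → ℝ) (t : ℕ) (c : Config P.L P.R) : Prop :=
  ∃ s : ℕ, t = s + 1 ∧ (fun o => Option.bind o (P.step E))^[s] (some ⟨P.start, 0, m₀⟩) = some c ∧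
    P.code c.label = .halt

/-- Started with an empty memory, the program halts after `t` operations and outputs the list `p`:
the output register holds the length of `p`, and the first memory cells hold its entries. -/
def OutputsList (P : Program w k) (E : Env w k) (t : ℕ) (p : List ℝ) : Prop :=
  ∃ c, P.HaltsWith E 0 t c ∧ c.reg P.out = p.length ∧ ∀ i (h : i < p.length), c.mem i = p[i]

end Program

/-- Input records `D 0, …, D (n - 1)` with entries in `[0, 1]`, together with an oracle. -/
noncomputable def recordsEnv {n w k : ℕ} (D : Fin n → Fin w → I) (o : (Fin k → ℝ) → Option ℝ) :
    Env w k where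
  size := n
  input i j := if h : i < n then (D ⟨i, h⟩ j : ℝ) else 0
  oracle := o

/-- The oracle that never answers. -/
def noOracle {k : ℕ} : (Fin k → ℝ) → Option ℝ := fun _ => none

open Classical in
/-- The oracle for a function on the cube `[0, 1]^k`. -/
noncomputable def oracleOf {k : ℕ} (h : (Fin k → I) → ℝ) : (Fin k → ℝ) → Option ℝ := fun v =>
  if hv : ∀ j, v j ∈ I then some (h fun j => ⟨v j, hv j⟩) else none

/-- With the parameters `p` in its memory and the point `x` as its input record, the program
returns the number `y` after `t` operations. -/
def Program.Evaluates {k : ℕ} (P : Program k 0) (p : List ℝ) (x : Fin k → I) (t : ℕ) (y : ℝ) :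
    Prop :=
  ∃ c, P.HaltsWith (recordsEnv (fun _ : Fin 1 => x) noOracle) (fun i => p.getD i 0) t c ∧
    c.reg P.out = y

/-! ### Operations, data and distribution operation functions -/

/-- The rank operation (on one-dimensional data) and the cardinality operation on
`d`-dimensional data. -/
inductive Operation : Type
  | rank
  | card (d : ℕ)

namespace Operation

/-- The dimension of the data. -/
def dim : Operation → ℕ
  | rank => 1
  | card d => d

/-- The number of coordinates of a query. -/
def arity : Operation → ℕ
  | rank => 1
  | card d => d + d

abbrev Record (op : Operation) : Type := Fin op.dim → I

abbrev Query (op : Operation) : Type := Fin op.arity → I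

/-- Which records a query counts. Rank: the records smaller than the query point. Cardinality: a
query `(c₁, …, c_d, r₁, …, r_d)` counts the records in the box `∏ᵢ [cᵢ, cᵢ + rᵢ]`. -/
def Matches : (op : Operation) → op.Query → op.Record → Prop
  | rank, q, z => z (0 : Fin 1) < q (0 : Fin 1)
  | card d, q, z => ∀ i : Fin d, (q (Fin.castAdd d i) : ℝ) ≤ (z i : ℝ) ∧
      (z i : ℝ) ≤ (q (Fin.castAdd d i) : ℝ) + (q (Fin.natAdd d i) : ℝ)

/-- The operation function `f_D`: the number of records of `D` that match the query. -/
noncomputable def count (op : Operation) {n : ℕ} (D : Fin n → op.Record) (x : op.Query) : ℝ :=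
  (Nat.card {i : Fin n // op.Matches x (D i)} : ℝ)

/-- The law of a data set whose `i`-th record is drawn independently from `χ i`. -/
noncomputable def dataLaw (op : Operation) {n : ℕ} (χ : Fin n → ProbabilityMeasure op.Record) :
    Measure (Fin n → op.Record) :=
  Measure.pi fun i => (χ i : Measure op.Record)

/-- The distribution operation function `f_χ(x) = E[f_D(x)]`, where `D` has the law of `χ`. -/
noncomputable def distFn (op : Operation) {n : ℕ} (χ : Fin n → ProbabilityMeasure op.Record)
    (x : op.Query) : ℝ :=
  ∫ D, op.count D x ∂(op.dataLaw χ)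

end Operation

/-- The uniform distance `‖f - g‖_∞`. -/
noncomputable def supDist {Q : Type*} (f g : Q → ℝ) : ℝ≥0∞ := ⨆ x, edist (f x) (g x)

/-- The ways to sample from a distribution class: independent records, each from its own member of
the class. -/
def independentFrom {Z : Type*} [MeasurableSpace Z] (𝔛 : Set (ProbabilityMeasure Z)) (n : ℕ) :
    Set (Fin n → ProbabilityMeasure Z) :=
  {χ | ∀ i, χ i ∈ 𝔛}

/-- The ways to sample identically distributed independent records from a distribution class. -/
def iidFrom {Z : Type*} [MeasurableSpace Z] (𝔛 : Set (ProbabilityMeasure Z)) (n : ℕ) :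
    Set (Fin n → ProbabilityMeasure Z) :=
  {χ | ∃ ν ∈ 𝔛, ∀ i, χ i = ν}

/-! ### Function classes with a hyperparameter -/

/-- A class of models for a hyperparameter in `Θ`: for every value `ϑ` an inference program and the
set of the parameter lists that may be stored for it. -/
structure ModelClass (op : Operation) (Θ : Type*) where
  infer : Θ → Program op.arity 0
  params : Θ → Set (List ℝ)

namespace ModelClass

variable {op : Operation} {Θ : Type*}

/-- The parameters `p` are a model in `F_ϑ` of the function `f`. -/
def Represents (F : ModelClass op Θ) (ϑ : Θ) (p : List ℝ) (f : op.Query → ℝ) : Prop :=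
  p ∈ F.params ϑ ∧ ∀ x, ∃ t, (F.infer ϑ).Evaluates p x t (f x)

/-- `F_ϑ`, as a set of functions. -/
def functions (F : ModelClass op Θ) (ϑ : Θ) : Set (op.Query → ℝ) := {f | ∃ p, F.Represents ϑ p f}

/-- The maximum number of operations of a forward pass in `F_ϑ`. -/
noncomputable def inferenceTime (F : ModelClass op Θ) (ϑ : Θ) : ℕ∞ :=
  sSup {T | ∃ p f x t, F.Represents ϑ p f ∧ (F.infer ϑ).Evaluates p x t (f x) ∧ T = (t : ℕ∞)}

/-- The maximum space needed for a model in `F_ϑ`: its parameters and its inference program. -/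
noncomputable def space (F : ModelClass op Θ) (ϑ : Θ) : ℕ∞ :=
  sSup {S | ∃ p f, F.Represents ϑ p f ∧ S = (((F.infer ϑ).size + p.length : ℕ) : ℕ∞)}

/-- `α` is the representation complexity function of `F` for `G`: for every `ε > 0`, `α ε` is the
smallest `ϑ` such that every `g ∈ G` is within `ε` of some `f ∈ F_ϑ`. -/
def IsRepresentationComplexity [Preorder Θ] (F : ModelClass op Θ) (G : Set (op.Query → ℝ))
    (α : ℝ → Θ) : Prop :=
  ∀ ε : ℝ, 0 < ε →
    IsLeast {ϑ | ∀ g ∈ G, ∃ f ∈ F.functions ϑ, supDist f g ≤ ENNReal.ofReal ε} (α ε)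

end ModelClass

/-- What an optimization algorithm is run on: the function `h = f_D / n` as an oracle (one operation
per evaluation), and the records of `D`. -/
noncomputable def optEnv (op : Operation) {n : ℕ} (D : Fin n → op.Record) : Env op.dim op.arity :=
  recordsEnv D (oracleOf fun x => op.count D x / n)

/-- `F` is approximately optimizable by `A`, with the constants `κ` and `κ'`: for `h = f_D / n` and
every `ϑ`, `A` halts and returns a model of some `h' ∈ F_ϑ` with
`‖h' - h‖ ≤ (1 / κ) ‖f - h‖ + κ' / √n` for all `f ∈ F_ϑ`. -/
def IsOptimizable {op : Operation} {Θ : Type*} (F : ModelClass op Θ)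
    (A : Θ → Program op.dim op.arity) (κ κ' : ℝ) : Prop :=
  ∀ (n : ℕ), 1 ≤ n → ∀ (D : Fin n → op.Record) (ϑ : Θ),
    ∃ t p h', (A ϑ).OutputsList (optEnv op D) t p ∧ F.Represents ϑ p h' ∧
      ∀ f ∈ F.functions ϑ,
        supDist h' (fun x => op.count D x / n) ≤
          ENNReal.ofReal (1 / κ) * supDist f (fun x => op.count D x / n) +
            ENNReal.ofReal (κ' / √n)

/-- The maximum number of operations of the algorithm with hyperparameter `ϑ` on the functions
`f_D / n`, over all data sets `D` of size `n`. -/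
noncomputable def optTime {op : Operation} {Θ : Type*} (A : Θ → Program op.dim op.arity)
    (n : ℕ) (ϑ : Θ) : ℕ∞ :=
  sSup {T | ∃ (D : Fin n → op.Record) (t : ℕ) (p : List ℝ),
    (A ϑ).OutputsList (optEnv op D) t p ∧ T = (t : ℕ∞)}

/-! ### Distribution learnability -/

/-- Distribution learnability for the operation `op`, with the parameters `T`, `S`, `B` and the
constants `κ₁`, `κ₂`, for data of the laws in `samp n`. The learning algorithm has no oracle: all it
is given are the `n` records. It is the same for all laws in `samp n`, and it takes `n * B n`
operations in total, that is `B n` amortized. -/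
def DistributionLearnable (op : Operation)
    (samp : (n : ℕ) → Set (Fin n → ProbabilityMeasure op.Record)) (κ₁ κ₂ : ℝ) (T S B : ℕ → ℕ∞) :
    Prop :=
  ∀ n : ℕ, 1 ≤ n → ∃ (train : Program op.dim 0) (infer : Program op.arity 0)
    (params : (Fin n → op.Record) → List ℝ) (model : (Fin n → op.Record) → op.Query → ℝ),
    -- training complexity
    (∀ D, ∃ t : ℕ, train.OutputsList (recordsEnv D noOracle) t (params D) ∧
      (t : ℕ∞) ≤ n * B n) ∧
    -- inference complexity
    (∀ D x, ∃ t : ℕ, infer.Evaluates (params D) x t (model D x) ∧ (t : ℕ∞) ≤ T n) ∧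
    (∀ D, ((infer.size + (params D).length : ℕ) : ℕ∞) ≤ S n) ∧
    -- accuracy
    (∀ χ ∈ samp n, ∀ ε : ℝ, √n ≤ ε →
      op.dataLaw χ {D | ENNReal.ofReal ε ≤ supDist (op.distFn χ) (model D)} ≤
        ENNReal.ofReal (κ₁ * Real.exp (-κ₂ * (ε / √n - 1) ^ 2)))

end LearnedDB

open LearnedDB

/-! The learner runs the optimizer on `h = f_D / n` at `ϑ = α(1/√n)`, answers every evaluation of
`h` by a scan of the `n` records, and multiplies the returned model by `n`. A scan costs `O((d + 1)
n)` operations, which is the factor `n` in the training bound; the rescaling costs a constant.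

Accuracy splits into a deterministic and a probabilistic half. If `f_D` is uniformly within `s√n` of
`f_χ`, then a model `f` within `1/√n` of `f_χ / n` is within `(1 + s)/√n` of `h`. The optimizer
therefore comes within `((1 + s)/κ + κ')/√n` of `h`, and `n ĥ` within `((1 + 1/κ) s + 1/κ + κ')√n`
of `f_χ` (`abs_distFn_sub_model_le`).

What remains is a tail `K exp(-c s²)` for the uniform deviation of `f_D` from `f_χ`, for independent
records with different laws and without a factor `log n` (`measure_exists_le_abs_empDev`). It is
proved by chaining with brackets. Matching sets are boxes cut out by two initial segments per
coordinate. With respect to the summed marginals, initial segments can be bracketed at level `k` by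
about `2^k` pairs with gaps of expected mass `n / 2^k`, so boxes need `2^(O(d+1) (k+1))` brackets
with gaps `O(d+1) n / 2^k` (`exists_cutBox_brackets`).

A bracket increment at level `k` has variance proxy of order `n / 2^k` and is allowed the size
`(3/4)^k l`, with `l` a multiple of `s√n`. The Chernoff exponent then grows like `s² (9/8)^k` and
beats the number of pairs, while the allowances form a convergent series. The Chernoff bound is
sub-Gaussian only while the allowance is below twice the variance proxy. This holds until `2^K` is
of order `d√n / s`, and there the expected mass of a gap is already a fraction of `s√n`, so the
chain may stop. -/

namespace LearnedDB

/-! ### Concentration of empirical counts -/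

section Concentration

open ProbabilityTheory
open scoped symmDiff

variable {Z : Type*} [MeasurableSpace Z] {n : ℕ}

/-- The number of points of `D` in `A`, minus its expectation if `D i` has the law `χ i`. -/
noncomputable def empDev (χ : Fin n → Measure Z) (A : Set Z) (D : Fin n → Z) : ℝ :=
  ∑ i, (A.indicator 1 (D i) - (χ i).real A)

/-- The expected number of points in `A`. -/
noncomputable def mass (χ : Fin n → Measure Z) (A : Set Z) : ℝ := ∑ i, (χ i).real A

lemma mass_mono (χ : Fin n → Measure Z) [∀ i, IsProbabilityMeasure (χ i)] {A B : Set Z}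
    (h : A ⊆ B) : mass χ A ≤ mass χ B :=
  Finset.sum_le_sum fun _ _ => measureReal_mono h

lemma mass_union_le (χ : Fin n → Measure Z) (A B : Set Z) :
    mass χ (A ∪ B) ≤ mass χ A + mass χ B := by
  rw [mass, mass, mass, ← Finset.sum_add_distrib]
  exact Finset.sum_le_sum fun _ _ => measureReal_union_le _ _

lemma mass_diff (χ : Fin n → Measure Z) [∀ i, IsProbabilityMeasure (χ i)] {A B : Set Z}
    (h : A ⊆ B) (hA : MeasurableSet A) : mass χ (B \ A) = mass χ B - mass χ A := by
  rw [mass, mass, mass, ← Finset.sum_sub_distrib]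
  exact Finset.sum_congr rfl fun _ _ => measureReal_sdiff h hA

lemma mass_le (χ : Fin n → Measure Z) [∀ i, IsProbabilityMeasure (χ i)] (A : Set Z) :
    mass χ A ≤ n := by
  refine (Finset.sum_le_sum (g := fun _ => (1 : ℝ)) fun _ _ => measureReal_le_one).trans ?_
  simp

lemma empDev_eq (χ : Fin n → Measure Z) (A : Set Z) (D : Fin n → Z) :
    empDev χ A D = ∑ i, A.indicator 1 (D i) - mass χ A := by
  rw [empDev, mass, Finset.sum_sub_distrib]

lemma measurable_empDev (χ : Fin n → Measure Z) {A : Set Z} (hA : MeasurableSet A) :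
    Measurable (empDev χ A) :=
  Finset.measurable_sum _ fun i _ =>
    ((measurable_one.indicator hA).comp (measurable_pi_apply i)).sub_const _

lemma abs_empDev_le (χ : Fin n → Measure Z) [∀ i, IsProbabilityMeasure (χ i)] (A : Set Z)
    (D : Fin n → Z) : |empDev χ A D| ≤ n := by
  have h : ∀ i, |A.indicator (1 : Z → ℝ) (D i) - (χ i).real A| ≤ 1 := fun i => by
    have h0 : 0 ≤ (χ i).real A := measureReal_nonneg
    have h1 : (χ i).real A ≤ 1 := measureReal_le_one
    rw [abs_le]
    by_cases hz : D i ∈ A <;> simp [hz] <;> linarith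
  calc |empDev χ A D| ≤ ∑ i, |A.indicator (1 : Z → ℝ) (D i) - (χ i).real A| :=
        Finset.abs_sum_le_sum_abs _ _
    _ ≤ ∑ _i : Fin n, (1 : ℝ) := Finset.sum_le_sum fun i _ => h i
    _ = n := by simp

/-- Combines `e^y ≤ 1 + y + y²` for `|y| ≤ 1` with `1 + u ≤ e^u`; the square of the difference of
the indicators is the indicator of `A ∆ B`, so the second-order term is the mass of the symmetric
difference. -/
lemma integral_exp_indicator_sub_le (ν : Measure Z) [IsProbabilityMeasure ν] {A B : Set Z}
    (hA : MeasurableSet A) (hB : MeasurableSet B) {θ : ℝ} (hθ : |θ| ≤ 1) :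
    ∫ z, Real.exp (θ * (A.indicator 1 z - B.indicator 1 z)) ∂ν ≤
      Real.exp (θ * (ν.real A - ν.real B) + θ ^ 2 * ν.real (A ∆ B)) := by
  have hAB : MeasurableSet (A ∆ B) := hA.symmDiff hB
  have iA : Integrable (A.indicator (1 : Z → ℝ)) ν := (integrable_const 1).indicator hA
  have iB : Integrable (B.indicator (1 : Z → ℝ)) ν := (integrable_const 1).indicator hB
  have iAB : Integrable ((A ∆ B).indicator (1 : Z → ℝ)) ν := (integrable_const 1).indicator hAB
  have iS : Integrable (fun z => A.indicator (1 : Z → ℝ) z - B.indicator 1 z) ν := iA.sub iB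
  have i1 : Integrable (fun z => 1 + θ * (A.indicator (1 : Z → ℝ) z - B.indicator 1 z)) ν :=
    (integrable_const 1).add (iS.const_mul θ)
  have i2 : Integrable (fun z => θ ^ 2 * (A ∆ B).indicator (1 : Z → ℝ) z) ν := iAB.const_mul _
  have hpt : ∀ z, Real.exp (θ * (A.indicator 1 z - B.indicator 1 z)) ≤
      1 + θ * (A.indicator (1 : Z → ℝ) z - B.indicator 1 z) +
        θ ^ 2 * (A ∆ B).indicator (1 : Z → ℝ) z := fun z => by
    have hy : ∀ y : ℝ, |y| ≤ 1 → Real.exp (θ * y) ≤ 1 + θ * y + θ ^ 2 * y ^ 2 := fun y hy => by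
      have := Real.abs_exp_sub_one_sub_id_le (x := θ * y)
        (by rw [abs_mul]; exact mul_le_one₀ hθ (abs_nonneg _) hy)
      have := (abs_le.1 this).2
      nlinarith
    by_cases ha : z ∈ A <;> by_cases hb : z ∈ B
    · simp [ha, hb, Set.mem_symmDiff]
    · simpa [ha, hb, Set.mem_symmDiff] using hy 1 (by simp)
    · simpa [ha, hb, Set.mem_symmDiff] using hy (-1) (by simp)
    · simp [ha, hb, Set.mem_symmDiff]
  calc ∫ z, Real.exp (θ * (A.indicator 1 z - B.indicator 1 z)) ∂ν
      ≤ ∫ z, (1 + θ * (A.indicator (1 : Z → ℝ) z - B.indicator 1 z) +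
        θ ^ 2 * (A ∆ B).indicator (1 : Z → ℝ) z) ∂ν :=
        integral_mono_of_nonneg (.of_forall fun _ => (Real.exp_pos _).le) (i1.add i2)
          (.of_forall hpt)
    _ = 1 + θ * (ν.real A - ν.real B) + θ ^ 2 * ν.real (A ∆ B) := by
        rw [integral_add i1 i2,
          integral_add (integrable_const 1) (iS.const_mul θ), integral_const_mul,
          integral_const_mul, integral_sub iA iB, integral_indicator_one hA,
          integral_indicator_one hB, integral_indicator_one hAB]
        simp
    _ ≤ _ := by
        have := Real.add_one_le_exp (θ * (ν.real A - ν.real B) + θ ^ 2 * ν.real (A ∆ B))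
        linarith

/-- Independence factors the moment generating function over the records, and the centring cancels
the linear term of each factor. -/
lemma mgf_empDev_sub_le (χ : Fin n → Measure Z) [∀ i, IsProbabilityMeasure (χ i)] {A B : Set Z}
    (hA : MeasurableSet A) (hB : MeasurableSet B) {θ : ℝ} (hθ : |θ| ≤ 1) :
    mgf (fun D => empDev χ A D - empDev χ B D) (Measure.pi χ) θ ≤
      Real.exp (θ ^ 2 * mass χ (A ∆ B)) := by
  have key : ∀ D : Fin n → Z, Real.exp (θ * (empDev χ A D - empDev χ B D)) =
      ∏ i, (Real.exp (-(θ * ((χ i).real A - (χ i).real B))) *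
        Real.exp (θ * (A.indicator 1 (D i) - B.indicator 1 (D i)))) := fun D => by
    rw [empDev, empDev, ← Finset.sum_sub_distrib, Finset.mul_sum, Real.exp_sum]
    refine Finset.prod_congr rfl fun i _ => ?_
    rw [← Real.exp_add]
    congr 1
    ring
  rw [mgf]
  simp_rw [key]
  rw [integral_fintype_prod_eq_prod (fun i z => Real.exp (-(θ * ((χ i).real A - (χ i).real B))) *
        Real.exp (θ * (A.indicator 1 z - B.indicator 1 z))), mass, Finset.mul_sum, Real.exp_sum]
  refine Finset.prod_le_prod (fun i _ => integral_nonneg fun _ => by positivity) fun i _ => ?_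
  rw [integral_const_mul]
  refine (mul_le_mul_of_nonneg_left (integral_exp_indicator_sub_le (χ i) hA hB hθ)
    (Real.exp_pos _).le).trans_eq ?_
  rw [← Real.exp_add]
  congr 1
  ring

/-- Chernoff's bound at `θ = l / (2V)`, the minimizer of `-θ l + θ² V`. The condition `l ≤ 2V` says
that `θ ≤ 1`. -/
lemma measure_le_empDev_sub (χ : Fin n → Measure Z) [∀ i, IsProbabilityMeasure (χ i)]
    {A B : Set Z} (hA : MeasurableSet A) (hB : MeasurableSet B) {V l : ℝ} (hV : 0 < V)
    (hAB : mass χ (A ∆ B) ≤ V) (hl : 0 ≤ l) (hlV : l ≤ 2 * V) :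
    (Measure.pi χ).real {D | l ≤ empDev χ A D - empDev χ B D} ≤ Real.exp (-(l ^ 2 / (4 * V))) := by
  have hθ0 : 0 ≤ l / (2 * V) := by positivity
  have hθ1 : |l / (2 * V)| ≤ 1 := by
    rw [abs_of_nonneg hθ0]
    exact div_le_one_of_le₀ hlV (by positivity)
  have hint : Integrable (fun D => Real.exp (l / (2 * V) * (empDev χ A D - empDev χ B D)))
      (Measure.pi χ) := by
    refine Integrable.of_bound (C := Real.exp (l / (2 * V) * (n + n))) ?_ (.of_forall fun D => ?_)
    · exact (((measurable_empDev χ hA).sub (measurable_empDev χ hB)).const_mul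
        _).exp.aestronglyMeasurable
    · rw [Real.norm_eq_abs, Real.abs_exp]
      have h1 := (abs_le.1 (abs_empDev_le χ A D)).2
      have h2 := (abs_le.1 (abs_empDev_le χ B D)).1
      gcongr
      linarith
  refine (measure_ge_le_exp_mul_mgf l hθ0 hint).trans ?_
  refine (mul_le_mul_of_nonneg_left (mgf_empDev_sub_le χ hA hB hθ1) (Real.exp_pos _).le).trans ?_
  rw [← Real.exp_add, Real.exp_le_exp]
  have : (l / (2 * V)) ^ 2 * mass χ (A ∆ B) ≤ (l / (2 * V)) ^ 2 * V := by gcongr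
  have e : -(l / (2 * V)) * l + (l / (2 * V)) ^ 2 * V = -(l ^ 2 / (4 * V)) := by
    field_simp
    ring
  linarith

lemma measure_le_abs_empDev_sub (χ : Fin n → Measure Z) [∀ i, IsProbabilityMeasure (χ i)]
    {A B : Set Z} (hA : MeasurableSet A) (hB : MeasurableSet B) {V l : ℝ} (hV : 0 < V)
    (hAB : mass χ (A ∆ B) ≤ V) (hl : 0 ≤ l) (hlV : l ≤ 2 * V) :
    (Measure.pi χ).real {D | l ≤ |empDev χ A D - empDev χ B D|} ≤
      2 * Real.exp (-(l ^ 2 / (4 * V))) := by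
  have hsub : {D | l ≤ |empDev χ A D - empDev χ B D|} ⊆
      {D | l ≤ empDev χ A D - empDev χ B D} ∪ {D | l ≤ empDev χ B D - empDev χ A D} := by
    intro D hD
    rcases le_abs.1 hD.out with h | h
    · exact Or.inl h
    · exact Or.inr (by simpa using h)
  refine (measureReal_mono hsub).trans ((measureReal_union_le _ _).trans ?_)
  have h1 := measure_le_empDev_sub χ hA hB hV hAB hl hlV
  have h2 := measure_le_empDev_sub χ hB hA hV (by rwa [symmDiff_comm]) hl hlV
  linarith

/-- Union bound over finitely many pairs of sets. -/
lemma measure_exists_le_abs_empDev_sub (χ : Fin n → Measure Z) [∀ i, IsProbabilityMeasure (χ i)]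
    (T : Finset (Set Z × Set Z)) (hT : ∀ p ∈ T, MeasurableSet p.1 ∧ MeasurableSet p.2)
    {V l : ℝ} (hV : 0 < V) (hTV : ∀ p ∈ T, mass χ (p.1 ∆ p.2) ≤ V) (hl : 0 ≤ l)
    (hlV : l ≤ 2 * V) :
    (Measure.pi χ).real {D | ∃ p ∈ T, l ≤ |empDev χ p.1 D - empDev χ p.2 D|} ≤
      T.card * (2 * Real.exp (-(l ^ 2 / (4 * V)))) := by
  have h : {D | ∃ p ∈ T, l ≤ |empDev χ p.1 D - empDev χ p.2 D|} =
      ⋃ p ∈ T, {D | l ≤ |empDev χ p.1 D - empDev χ p.2 D|} := by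
    ext D
    simp
  rw [h]
  refine (measureReal_biUnion_finset_le T _).trans ?_
  rw [← nsmul_eq_mul]
  exact Finset.sum_le_card_nsmul _ _ _ fun p hp =>
    measure_le_abs_empDev_sub χ (hT p hp).1 (hT p hp).2 hV (hTV p hp) hl hlV

end Concentration

/-! ### Chaining with brackets -/

section Chaining

open scoped symmDiff

variable {Z : Type*}

open Classical in
/-- All sets that occur in the brackets of the levels `k` and `k + 1`. -/
noncomputable def bracketSets (B : ℕ → Finset (Set Z × Set Z)) (k : ℕ) : Finset (Set Z) :=
  insert ∅ ((B k ∪ B (k + 1)).image Prod.fst ∪ (B k ∪ B (k + 1)).image Prod.snd)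

lemma mem_bracketSets {B : ℕ → Finset (Set Z × Set Z)} {k : ℕ} {A : Set Z} :
    A ∈ bracketSets B k ↔ A = ∅ ∨ ∃ b, (b ∈ B k ∨ b ∈ B (k + 1)) ∧ (b.1 = A ∨ b.2 = A) := by
  simp only [bracketSets, Finset.mem_insert, Finset.mem_union, Finset.mem_image]
  refine or_congr_right ⟨?_, ?_⟩
  · rintro (⟨b, hb, h⟩ | ⟨b, hb, h⟩)
    exacts [⟨b, hb, .inl h⟩, ⟨b, hb, .inr h⟩]
  · rintro ⟨b, hb, h | h⟩
    exacts [.inl ⟨b, hb, h⟩, .inr ⟨b, hb, h⟩]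

lemma card_bracketSets_le {B : ℕ → Finset (Set Z × Set Z)} {d : ℕ}
    (hB : ∀ k, (B k).card ≤ 2 ^ (d * (k + 1))) (k : ℕ) :
    (bracketSets B k).card ≤ 2 ^ (d * (k + 2) + 3) := by
  classical
  have h0 : (B k ∪ B (k + 1)).card ≤ 2 ^ (d * (k + 2)) + 2 ^ (d * (k + 2)) :=
    (Finset.card_union_le _ _).trans (add_le_add
      ((hB k).trans (Nat.pow_le_pow_right (by norm_num) (Nat.mul_le_mul_left d (by omega))))
      (hB (k + 1)))
  have h1 := Finset.card_image_le (s := B k ∪ B (k + 1)) (f := Prod.fst)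
  have h2 := Finset.card_image_le (s := B k ∪ B (k + 1)) (f := Prod.snd)
  have h3 := Finset.card_union_le ((B k ∪ B (k + 1)).image Prod.fst)
    ((B k ∪ B (k + 1)).image Prod.snd)
  have h4 := Finset.card_insert_le ∅
    ((B k ∪ B (k + 1)).image Prod.fst ∪ (B k ∪ B (k + 1)).image Prod.snd)
  have h5 : 1 ≤ 2 ^ (d * (k + 2)) := Nat.one_le_two_pow
  rw [bracketSets, pow_add]
  convert (h4.trans (?_ : _ ≤ 2 ^ (d * (k + 2)) * 2 ^ 3)) using 1
  omega

variable [MeasurableSpace Z] {n : ℕ}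

/-- Counts and expectations are both monotone in the set, so the deviation of `S` lies between those
of the bracket ends up to the expected mass of the gap. -/
lemma abs_empDev_le_of_bracket (χ : Fin n → Measure Z) [∀ i, IsProbabilityMeasure (χ i)]
    {A S B : Set Z} (hA : MeasurableSet A) (hAS : A ⊆ S) (hSB : S ⊆ B) (D : Fin n → Z) :
    |empDev χ S D| ≤ |empDev χ A D| + |empDev χ B D - empDev χ A D| + mass χ (B \ A) := by
  have h1 : ∑ i, A.indicator (1 : Z → ℝ) (D i) ≤ ∑ i, S.indicator 1 (D i) :=
    Finset.sum_le_sum fun i _ =>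
      Set.indicator_le_indicator_of_subset hAS (fun _ => zero_le_one) _
  have h2 : ∑ i, S.indicator (1 : Z → ℝ) (D i) ≤ ∑ i, B.indicator 1 (D i) :=
    Finset.sum_le_sum fun i _ =>
      Set.indicator_le_indicator_of_subset hSB (fun _ => zero_le_one) _
  have h3 := mass_mono χ hAS
  have h4 := mass_mono χ hSB
  rw [mass_diff χ (hAS.trans hSB) hA]
  have h5 := neg_abs_le (empDev χ A D)
  have h6 := le_abs_self (empDev χ A D)
  have h7 := le_abs_self (empDev χ B D - empDev χ A D)
  have h8 := abs_nonneg (empDev χ B D - empDev χ A D)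
  simp only [empDev_eq] at *
  rw [abs_le]
  constructor <;> linarith

open Classical in
/-- The pairs of such sets that differ by mass at most `V`. -/
noncomputable def bracketPairs (χ : Fin n → Measure Z) (B : ℕ → Finset (Set Z × Set Z)) (V : ℝ)
    (k : ℕ) : Finset (Set Z × Set Z) :=
  {p ∈ bracketSets B k ×ˢ bracketSets B k | mass χ (p.1 ∆ p.2) ≤ V}

lemma mem_bracketPairs {χ : Fin n → Measure Z} {B : ℕ → Finset (Set Z × Set Z)} {V : ℝ} {k : ℕ}
    {p : Set Z × Set Z} : p ∈ bracketPairs χ B V k ↔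
      (p.1 ∈ bracketSets B k ∧ p.2 ∈ bracketSets B k) ∧ mass χ (p.1 ∆ p.2) ≤ V := by
  simp [bracketPairs]

lemma card_bracketPairs_le (χ : Fin n → Measure Z) {B : ℕ → Finset (Set Z × Set Z)} {d : ℕ}
    (hd : 1 ≤ d) (hB : ∀ k, (B k).card ≤ 2 ^ (d * (k + 1))) (V : ℝ) (k : ℕ) :
    (bracketPairs χ B V k).card ≤ 2 ^ (2 * d * (k + 5)) := by
  classical
  refine (Finset.card_filter_le _ _).trans ?_
  rw [Finset.card_product]
  refine (Nat.mul_le_mul (card_bracketSets_le hB k) (card_bracketSets_le hB k)).trans ?_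
  rw [← pow_add]
  exact Nat.pow_le_pow_right (by norm_num) (by nlinarith)

/-- If all increments along the pairs of brackets are small, then all deviations are small. -/
lemma abs_empDev_lt_of_chain (χ : Fin n → Measure Z) [∀ i, IsProbabilityMeasure (χ i)] {d : ℕ}
    (hd : 1 ≤ d) {B : ℕ → Finset (Set Z × Set Z)}
    (hmeas : ∀ k, ∀ b ∈ B k, MeasurableSet b.1 ∧ MeasurableSet b.2) {S : Set Z}
    (hS : ∀ k, ∃ b ∈ B k, b.1 ⊆ S ∧ S ⊆ b.2 ∧ mass χ (b.2 \ b.1) ≤ d * n / 2 ^ k)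
    {l : ℝ} {K : ℕ} {D : Fin n → Z}
    (h : ∀ k ≤ K, ∀ p ∈ bracketPairs χ B (4 * d * n / 2 ^ k) k,
      |empDev χ p.1 D - empDev χ p.2 D| < l * (3 / 4) ^ k) :
    |empDev χ S D| ≤ 6 * l + d * n / 2 ^ K := by
  choose b hb hlo hhi hm using hS
  have hdn : (0 : ℝ) ≤ d * n := by positivity
  -- The pair `(∅, ∅)` has increment `0`, so the hypothesis at level `0` already forces `l > 0`.
  have hl : 0 ≤ l := by
    by_contra! hl
    have : (∅, ∅) ∈ bracketPairs χ B (4 * d * n / 2 ^ 0) 0 := by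
      simp [mem_bracketPairs, mem_bracketSets, mass]
      positivity
    have := h 0 (Nat.zero_le _) _ this
    simp at this
    linarith
  -- The first link is an increment from `∅`, whose deviation is `0`; level `0` admits it because
  -- every mass is at most `n`.
  have hstart : |empDev χ (b 0).1 D| ≤ l := by
    have hp : ((b 0).1, (∅ : Set Z)) ∈ bracketPairs χ B (4 * d * n / 2 ^ 0) 0 := by
      refine mem_bracketPairs.2 ⟨⟨mem_bracketSets.2 (.inr ⟨b 0, .inl (hb 0), .inl rfl⟩),
        mem_bracketSets.2 (.inl rfl)⟩, (mass_le χ _).trans ?_⟩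
      have : (1 : ℝ) ≤ d := by exact_mod_cast hd
      have : (0 : ℝ) ≤ n := by positivity
      simp only [pow_zero, div_one]
      nlinarith
    have := h 0 (Nat.zero_le _) _ hp
    have e : empDev χ ∅ D = 0 := by simp [empDev]
    simp only [e, sub_zero, pow_zero, mul_one] at this
    exact this.le
  have hstep : ∀ k, k + 1 ≤ K →
      |empDev χ (b k).1 D - empDev χ (b (k + 1)).1 D| ≤ l * (3 / 4) ^ k := fun k hk => by
    refine (h k (by omega) ((b k).1, (b (k + 1)).1) (mem_bracketPairs.2
      ⟨⟨mem_bracketSets.2 (.inr ⟨b k, .inl (hb k), .inl rfl⟩),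
        mem_bracketSets.2 (.inr ⟨b (k + 1), .inr (hb (k + 1)), .inl rfl⟩)⟩, ?_⟩)).le
    -- Both lower ends lie inside `S`, so a point of only one of them lies in the gap of the other
    -- bracket.
    have hsub : (b k).1 ∆ (b (k + 1)).1 ⊆
        ((b k).2 \ (b k).1) ∪ ((b (k + 1)).2 \ (b (k + 1)).1) := by
      rintro z (⟨h1, h2⟩ | ⟨h1, h2⟩)
      · exact .inr ⟨hhi _ (hlo _ h1), h2⟩
      · exact .inl ⟨hhi _ (hlo _ h1), h2⟩
    refine (mass_mono χ hsub).trans ((mass_union_le χ _ _).trans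
      ((add_le_add (hm k) (hm (k + 1))).trans ?_))
    have h1 : (d * n : ℝ) / 2 ^ (k + 1) ≤ d * n / 2 ^ k := by
      gcongr
      · norm_num
      · omega
    have h2 : (4 * d * n : ℝ) / 2 ^ k = 4 * (d * n / 2 ^ k) := by ring
    have h3 : (0 : ℝ) ≤ d * n / 2 ^ k := by positivity
    rw [h2]
    linarith
  have hlo_bound : ∀ k ≤ K,
      |empDev χ (b k).1 D| ≤ l + l * ∑ j ∈ Finset.range k, (3 / 4 : ℝ) ^ j := by
    intro k
    induction k with
    | zero => simpa using hstart
    | succ k ih =>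
      intro hk
      have h1 := ih (by omega)
      have h2 := hstep k hk
      have h3 := abs_sub_abs_le_abs_sub (empDev χ (b (k + 1)).1 D) (empDev χ (b k).1 D)
      rw [abs_sub_comm] at h3
      rw [Finset.sum_range_succ]
      linarith
  have hgeom : ∑ j ∈ Finset.range K, (3 / 4 : ℝ) ^ j ≤ 4 := by
    have e : ∑ j ∈ Finset.range K, (3 / 4 : ℝ) ^ j = 4 * (1 - (3 / 4) ^ K) := by
      rw [geom_sum_eq (by norm_num)]
      ring
    have : (0 : ℝ) ≤ (3 / 4) ^ K := by positivity
    rw [e]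
    linarith
  -- The chain runs through lower ends only; the upper end is needed just once, at the last level.
  have hlast : |empDev χ (b K).2 D - empDev χ (b K).1 D| ≤ l := by
    have hV : (d * n : ℝ) / 2 ^ K ≤ 4 * d * n / 2 ^ K := by
      gcongr
      linarith
    have hmem : ((b K).2, (b K).1) ∈ bracketPairs χ B (4 * d * n / 2 ^ K) K := by
      refine mem_bracketPairs.2 ⟨⟨mem_bracketSets.2 (.inr ⟨b K, .inl (hb K), .inr rfl⟩),
        mem_bracketSets.2 (.inr ⟨b K, .inl (hb K), .inl rfl⟩)⟩, ?_⟩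
      rw [Set.symmDiff_def, Set.sdiff_eq_empty.2 ((hlo K).trans (hhi K)), Set.union_empty]
      exact (hm K).trans hV
    refine (h K le_rfl _ hmem).le.trans (mul_le_of_le_one_right hl ?_)
    exact pow_le_one₀ (by norm_num) (by norm_num)
  have h1 := abs_empDev_le_of_bracket χ (hmeas K _ (hb K)).1 (hlo K) (hhi K) D
  have h2 := hlo_bound K le_rfl
  have h3 := mul_le_mul_of_nonneg_left hgeom hl
  have h4 := hm K
  linarith

/-- With `c = s² / (1600 d) ≥ 64 d` and Bernoulli's `(9/8)^k ≥ 1 + k/8`, half of `c` is kept for the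
tail. The remaining `c/2 + c k/8` pays for the number of pairs and for the summable factor `2^(-k)`.
-/
lemma pairs_tail_le {d : ℕ} (hd : 1 ≤ d) {s : ℝ} (hs : 102400 * (d : ℝ) ^ 2 ≤ s ^ 2) (k : ℕ) :
    (2 : ℝ) ^ (2 * d * (k + 5)) * (2 * Real.exp (-(s ^ 2 / (1600 * d) * (9 / 8) ^ k))) ≤
      2 * Real.exp (-(s ^ 2 / (3200 * d))) * (1 / 2) ^ k := by
  have hd' : (1 : ℝ) ≤ d := by exact_mod_cast hd
  have hc : 64 * (d : ℝ) ≤ s ^ 2 / (1600 * d) := by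
    rw [le_div_iff₀ (by positivity)]
    linarith
  have e2 : s ^ 2 / (3200 * d) = s ^ 2 / (1600 * d) / 2 := by
    rw [div_div]
    ring
  set c := s ^ 2 / (1600 * d)
  have hbern : 1 + (k : ℝ) * (1 / 8) ≤ (9 / 8) ^ k := by
    have := one_add_mul_le_pow (a := (1 / 8 : ℝ)) (by norm_num) k
    norm_num at this ⊢
    exact this
  have h2 : (2 : ℝ) ≤ Real.exp 1 := by
    have := Real.add_one_le_exp (1 : ℝ)
    linarith
  have hp : (2 : ℝ) ^ (2 * d * (k + 5)) ≤ Real.exp (2 * d * (k + 5)) := by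
    calc (2 : ℝ) ^ (2 * d * (k + 5)) ≤ Real.exp 1 ^ (2 * d * (k + 5)) := by gcongr
      _ = _ := by
        rw [← Real.exp_nat_mul]
        push_cast
        ring_nf
  have hk : Real.exp (-(k : ℝ)) ≤ (1 / 2) ^ k := by
    have : Real.exp (-1) ≤ 1 / 2 := by
      rw [Real.exp_neg, one_div]
      gcongr
    calc Real.exp (-(k : ℝ)) = Real.exp (-1) ^ k := by
          rw [← Real.exp_nat_mul]
          ring_nf
      _ ≤ _ := by gcongr
  have hk0 : (0 : ℝ) ≤ k := by positivity
  have hmain : 2 * d * (k + 5) + -(c * (9 / 8) ^ k) ≤ -(c / 2) + -(k : ℝ) := by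
    have hc0 : 0 ≤ c := by linarith
    have h1 := mul_le_mul_of_nonneg_left hbern hc0
    have h2 := mul_le_mul_of_nonneg_right hc hk0
    have h3 := mul_le_mul_of_nonneg_right hd' hk0
    nlinarith
  calc (2 : ℝ) ^ (2 * d * (k + 5)) * (2 * Real.exp (-(c * (9 / 8) ^ k)))
      ≤ Real.exp (2 * d * (k + 5)) * (2 * Real.exp (-(c * (9 / 8) ^ k))) := by gcongr
    _ = 2 * Real.exp (2 * d * (k + 5) + -(c * (9 / 8) ^ k)) := by
        rw [Real.exp_add]
        ring
    _ ≤ 2 * Real.exp (-(c / 2) + -(k : ℝ)) := by gcongr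
    _ = 2 * Real.exp (-(c / 2)) * Real.exp (-(k : ℝ)) := by
        rw [Real.exp_add]
        ring
    _ ≤ _ := by
        rw [e2]
        gcongr

/-- A sub-Gaussian bound for the uniform deviation over a class of sets with small brackets. -/
theorem measure_exists_le_abs_empDev (χ : Fin n → Measure Z) [∀ i, IsProbabilityMeasure (χ i)]
    (hn : 1 ≤ n) {d : ℕ} (hd : 1 ≤ d) (𝒮 : Set (Set Z)) (B : ℕ → Finset (Set Z × Set Z))
    (hmeas : ∀ k, ∀ b ∈ B k, MeasurableSet b.1 ∧ MeasurableSet b.2)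
    (hcard : ∀ k, (B k).card ≤ 2 ^ (d * (k + 1)))
    (hcover : ∀ S ∈ 𝒮, ∀ k, ∃ b ∈ B k, b.1 ⊆ S ∧ S ⊆ b.2 ∧ mass χ (b.2 \ b.1) ≤ d * n / 2 ^ k)
    {s : ℝ} (hs : 0 < s) :
    (Measure.pi χ).real {D | ∃ S ∈ 𝒮, s * √n ≤ |empDev χ S D|} ≤
      4 * Real.exp (32 * d) * Real.exp (-(s ^ 2 / (3200 * d))) := by
  have hd' : (1 : ℝ) ≤ d := by exact_mod_cast hd
  have hn' : (1 : ℝ) ≤ n := by exact_mod_cast hn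
  have hsn : 0 < √(n : ℝ) := Real.sqrt_pos.2 (by linarith)
  have hsq : √(n : ℝ) * √n = n := Real.mul_self_sqrt (by linarith)
  -- Below this threshold the factor `exp (32 d)` makes the bound exceed `1`.
  rcases lt_or_ge (s ^ 2) (102400 * (d : ℝ) ^ 2) with hsmall | hlarge
  · refine measureReal_le_one.trans ?_
    rw [mul_assoc, ← Real.exp_add]
    have : s ^ 2 / (3200 * d) ≤ 32 * d := by
      rw [div_le_iff₀ (by positivity)]
      nlinarith
    have := Real.one_le_exp (x := 32 * d + -(s ^ 2 / (3200 * d))) (by linarith)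
    linarith
  -- A deviation never exceeds `n`, so for `s > √n` the event is empty.
  rcases lt_or_ge (√(n : ℝ)) s with hns | hns
  · have : {D : Fin n → Z | ∃ S ∈ 𝒮, s * √n ≤ |empDev χ S D|} = ∅ := by
      refine Set.eq_empty_of_forall_notMem ?_
      rintro D ⟨S, -, h⟩
      have := abs_empDev_le χ S D
      nlinarith
    rw [this, measureReal_empty]
    positivity
  have hx : 1 ≤ 4 * d * √(n : ℝ) / s := by
    rw [le_div_iff₀ hs]
    nlinarith
  -- `2^K` lies within a factor `2` above `4 d √n / s`: large enough for the final gap to be at most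
  -- `s√n / 4`, small enough for the Chernoff condition at all levels up to `K`.
  obtain ⟨m, hm1, hm2⟩ := exists_nat_pow_near hx one_lt_two
  set K := m + 1
  have hK : (2 : ℝ) ^ K ≤ 8 * d * √n / s := by
    calc (2 : ℝ) ^ K = 2 * 2 ^ m := by rw [pow_succ]; ring
      _ ≤ 2 * (4 * d * √(n : ℝ) / s) := by gcongr
      _ = _ := by ring
  -- The chain costs `6 l` and the last gap `s√n / 4`, together less than `s√n`.
  set l := s * √(n : ℝ) / 10
  have hl : 0 < l := by positivity
  let V : ℕ → ℝ := fun k => 4 * d * n / 2 ^ k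
  have hV : ∀ k, 0 < V k := fun k => by positivity
  have hreg : ∀ k ≤ K, l * (3 / 4) ^ k ≤ 2 * V k := fun k hk => by
    have h1 : (3 / 2 : ℝ) ^ k ≤ 8 * d * √n / s :=
      calc (3 / 2 : ℝ) ^ k ≤ 2 ^ k := by gcongr; norm_num
        _ ≤ 2 ^ K := by gcongr; norm_num
        _ ≤ _ := hK
    have h2 : l * (3 / 4) ^ k = l * (3 / 2) ^ k / 2 ^ k := by
      rw [mul_div_assoc, ← div_pow]
      norm_num
    have h3 : 2 * V k = 8 * d * n / 2 ^ k := by simp only [V]; ring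
    rw [h2, h3]
    refine div_le_div_of_nonneg_right ?_ (by positivity)
    calc l * (3 / 2) ^ k ≤ l * (8 * d * √n / s) := by gcongr
      _ = 8 * d * (√(n : ℝ) * √n) / 10 := by simp only [l]; field_simp
      _ ≤ 8 * d * n := by
        rw [hsq]
        have : 0 ≤ 8 * (d : ℝ) * n := by positivity
        linarith
  let bad : ℕ → Set (Fin n → Z) := fun k => {D | ∃ p ∈ bracketPairs χ B (V k) k,
    l * (3 / 4) ^ k ≤ |empDev χ p.1 D - empDev χ p.2 D|}
  have hbad : ∀ k ∈ Finset.range (K + 1), (Measure.pi χ).real (bad k) ≤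
      2 * Real.exp (-(s ^ 2 / (3200 * d))) * (1 / 2) ^ k := fun k hk => by
    have hk' : k ≤ K := by simpa [Nat.lt_succ_iff] using hk
    have hMeas : ∀ A ∈ bracketSets B k, MeasurableSet A := fun A hA => by
      rcases mem_bracketSets.1 hA with rfl | ⟨b, hb, hA⟩
      · exact MeasurableSet.empty
      · have : MeasurableSet b.1 ∧ MeasurableSet b.2 := hb.elim (hmeas _ b) (hmeas _ b)
        rcases hA with rfl | rfl
        exacts [this.1, this.2]
    refine (measure_exists_le_abs_empDev_sub χ (bracketPairs χ B (V k) k)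
      (fun p hp => ⟨hMeas _ (mem_bracketPairs.1 hp).1.1, hMeas _ (mem_bracketPairs.1 hp).1.2⟩)
      (hV k) (fun p hp => (mem_bracketPairs.1 hp).2) (by positivity) (hreg k hk')).trans ?_
    refine le_trans ?_ (pairs_tail_le hd hlarge k)
    -- The squared allowance shrinks by `9/16` per level and the variance proxy by `1/2`; the
    -- quotient grows by `9/8`.
    have hexp : (l * (3 / 4) ^ k) ^ 2 / (4 * V k) = s ^ 2 / (1600 * d) * (9 / 8) ^ k := by
      have h98 : (9 / 8 : ℝ) ^ k = ((3 / 4) ^ k) ^ 2 * 2 ^ k := by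
        rw [← pow_mul, mul_comm k 2, pow_mul, ← mul_pow]
        norm_num
      have hl2 : l ^ 2 = s ^ 2 * n / 100 := by
        simp only [l]
        rw [div_pow, mul_pow, Real.sq_sqrt (by linarith)]
        norm_num
      rw [h98, mul_pow, hl2]
      simp only [V]
      field_simp
      norm_num
    rw [hexp]
    gcongr
    exact_mod_cast card_bracketPairs_le χ hd hcard (V k) k
  -- The event for an uncountable class is put inside a finite union, so its own measurability is
  -- not needed.
  have hsub : {D : Fin n → Z | ∃ S ∈ 𝒮, s * √n ≤ |empDev χ S D|} ⊆
      ⋃ k ∈ Finset.range (K + 1), bad k := by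
    rintro D ⟨S, hS, hD⟩
    by_contra hcon
    simp only [bad, Set.mem_iUnion, Finset.mem_range, not_exists, Nat.lt_succ_iff] at hcon
    have := abs_empDev_lt_of_chain χ hd hmeas (hcover S hS) (l := l) (K := K) (D := D)
      fun k hk p hp => by
        by_contra! hlt
        exact hcon k hk ⟨p, hp, hlt⟩
    have hbias : (d * n : ℝ) / 2 ^ K ≤ s * √n / 4 := by
      rw [div_le_iff₀ (by positivity)]
      rw [div_lt_iff₀ hs] at hm2
      nlinarith
    have : 0 < s * √n := by positivity
    simp only [l] at *
    linarith
  calc (Measure.pi χ).real {D : Fin n → Z | ∃ S ∈ 𝒮, s * √n ≤ |empDev χ S D|}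
      ≤ (Measure.pi χ).real (⋃ k ∈ Finset.range (K + 1), bad k) := measureReal_mono hsub (measure_ne_top _ _)
    _ ≤ ∑ k ∈ Finset.range (K + 1), (Measure.pi χ).real (bad k) := measureReal_biUnion_finset_le _ _
    _ ≤ ∑ k ∈ Finset.range (K + 1), 2 * Real.exp (-(s ^ 2 / (3200 * d))) * (1 / 2) ^ k :=
        Finset.sum_le_sum hbad
    _ = 2 * Real.exp (-(s ^ 2 / (3200 * d))) * ∑ k ∈ Finset.range (K + 1), (1 / 2 : ℝ) ^ k :=
        (Finset.mul_sum _ _ _).symm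
    _ ≤ 2 * Real.exp (-(s ^ 2 / (3200 * d))) * 2 := by
        gcongr
        exact sum_geometric_two_le _
    _ ≤ _ := by
        have h1 := Real.one_le_exp (x := 32 * (d : ℝ)) (by linarith)
        have h2 := Real.exp_pos (-(s ^ 2 / (3200 * (d : ℝ))))
        nlinarith

end Chaining

/-! ### Brackets for initial segments and for boxes -/

section Brackets

/-- If the supremum is attained, a constant sequence works; otherwise a monotone sequence in `T`
converging to it does. This makes continuity from below available for arbitrary initial segments. -/
lemma exists_monotone_iUnion_Iic {α : Type*} [ConditionallyCompleteLinearOrder α]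
    [TopologicalSpace α] [OrderTopology α] [FirstCountableTopology α] {T : Set α}
    (hT : IsLowerSet T) (hne : T.Nonempty) (hbdd : BddAbove T) :
    ∃ u : ℕ → α, Monotone u ∧ (∀ k, u k ∈ T) ∧ T = ⋃ k, Set.Iic (u k) := by
  obtain ⟨u, hu, hlim, hmem⟩ := exists_seq_tendsto_sSup hne hbdd
  by_cases htop : sSup T ∈ T
  · refine ⟨fun _ => sSup T, monotone_const, fun _ => htop, ?_⟩
    ext z
    simp only [Set.mem_iUnion, Set.mem_Iic, exists_const]
    exact ⟨fun hz => le_csSup hbdd hz, fun hz => hT hz htop⟩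
  · refine ⟨u, hu, hmem, ?_⟩
    ext z
    simp only [Set.mem_iUnion, Set.mem_Iic]
    refine ⟨fun hz => ?_, fun ⟨k, hk⟩ => hT hk (hmem k)⟩
    have hlt : z < sSup T := lt_of_le_of_ne (le_csSup hbdd hz) fun h => htop (h ▸ hz)
    obtain ⟨k, hk⟩ := (hlim.eventually (lt_mem_nhds hlt)).exists
    exact ⟨k, hk.le⟩

/-- The union is exhausted by increasing closed segments `Iic (u k)`, each contained in a member of
the family; continuity from below keeps the bound. -/
lemma measure_sUnion_isLowerSet_le (ν : Measure I) (v : ℝ≥0∞) :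
    ν (⋃₀ {S | IsLowerSet S ∧ ν S ≤ v}) ≤ v := by
  set T := ⋃₀ {S | IsLowerSet S ∧ ν S ≤ v}
  have hT : IsLowerSet T := isLowerSet_sUnion fun S hS => hS.1
  rcases T.eq_empty_or_nonempty with h | h
  · simp [h]
  obtain ⟨u, hu, hmem, hTu⟩ := exists_monotone_iUnion_Iic hT h (OrderTop.bddAbove _)
  rw [hTu, Monotone.measure_iUnion fun a b hab => Set.Iic_subset_Iic.2 (hu hab)]
  refine iSup_le fun k => ?_
  obtain ⟨S, hS, hk⟩ := hmem k
  exact (measure_mono fun z hz => hS.1 hz hk).trans hS.2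

lemma measure_sUnion_isUpperSet_le (ν : Measure I) (v : ℝ≥0∞) :
    ν (⋃₀ {S | IsUpperSet S ∧ ν S ≤ v}) ≤ v := by
  set T := ⋃₀ {S | IsUpperSet S ∧ ν S ≤ v}
  have hT : IsUpperSet T := isUpperSet_sUnion fun S hS => hS.1
  rcases T.eq_empty_or_nonempty with h | h
  · simp [h]
  obtain ⟨u, hu, hmem, hTu⟩ := exists_monotone_iUnion_Iic (α := Iᵒᵈ)
    (T := OrderDual.ofDual ⁻¹' T) hT.toDual h (OrderTop.bddAbove _)
  have hTu' : T = ⋃ k, Set.Ici (OrderDual.ofDual (u k)) := hTu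
  rw [hTu', Monotone.measure_iUnion fun a b hab =>
    Set.Ici_subset_Ici.2 (OrderDual.ofDual_le_ofDual.2 (hu hab))]
  refine iSup_le fun k => ?_
  obtain ⟨S, hS, hk⟩ := hmem k
  exact (measure_mono fun z hz => hS.1 hz hk).trans hS.2

/-- The union of the initial segments of measure at most `v`. -/
def upperBracket (ν : Measure I) (v : ℝ) : Set I := ⋃₀ {S | IsLowerSet S ∧ ν S ≤ .ofReal v}

/-- The complement of the union of the final segments of measure at most `v`. -/
def lowerBracket (ν : Measure I) (v : ℝ) : Set I := (⋃₀ {S | IsUpperSet S ∧ ν S ≤ .ofReal v})ᶜ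

lemma measurableSet_upperBracket (ν : Measure I) (v : ℝ) : MeasurableSet (upperBracket ν v) :=
  (isLowerSet_sUnion fun _ hS => hS.1).ordConnected.measurableSet

lemma measurableSet_lowerBracket (ν : Measure I) (v : ℝ) : MeasurableSet (lowerBracket ν v) :=
  (isUpperSet_sUnion fun _ hS => hS.1).ordConnected.measurableSet.compl

/-- Brackets are indexed by values of the measure instead of cut points, so atoms do no harm. With
`m = ⌊ν(S) M / c⌋`, the upper end has measure at most `(m + 1) c / M` and the lower end at least `m
c / M`. -/
lemma exists_bracket (ν : Measure I) [IsFiniteMeasure ν] {c : ℝ} (hc : 0 < c)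
    (hν : ν.real Set.univ = c) {M : ℕ} (hM : 1 ≤ M) {S : Set I} (hS : IsLowerSet S) :
    ∃ m : Fin (M + 1), lowerBracket ν (c - m * c / M) ⊆ S ∧ S ⊆ upperBracket ν ((m + 1) * c / M) ∧
      ν.real (upperBracket ν ((m + 1) * c / M) \ lowerBracket ν (c - m * c / M)) ≤ c / M := by
  have hM' : (0 : ℝ) < M := by exact_mod_cast hM
  have hSm : MeasurableSet S := hS.ordConnected.measurableSet
  have hv0 : 0 ≤ ν.real S := measureReal_nonneg
  have hvc : ν.real S ≤ c := hν ▸ measureReal_mono (Set.subset_univ S)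
  have hx0 : 0 ≤ ν.real S * M / c := by positivity
  -- The index `M` itself occurs when `S` has full measure, hence `M + 1` brackets.
  have hmM : ⌊ν.real S * M / c⌋₊ < M + 1 := by
    rw [Nat.lt_succ_iff]
    refine Nat.floor_le_of_le ?_
    rw [div_le_iff₀ hc]
    nlinarith
  refine ⟨⟨⌊ν.real S * M / c⌋₊, hmM⟩, ?_⟩
  have h1 := Nat.floor_le hx0
  have h2 := (Nat.lt_floor_add_one (ν.real S * M / c)).le
  simp only
  set m : ℝ := (⌊ν.real S * M / c⌋₊ : ℝ)
  have hm : m * c / M ≤ ν.real S := by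
    rw [div_le_iff₀ hM']
    rwa [le_div_iff₀ hc] at h1
  have hm' : ν.real S ≤ (m + 1) * c / M := by
    rw [le_div_iff₀ hM']
    rwa [div_le_iff₀ hc] at h2
  have hlo : lowerBracket ν (c - m * c / M) ⊆ S := by
    refine Set.compl_subset_comm.1 (Set.subset_sUnion_of_mem ⟨hS.compl, ?_⟩)
    rw [← ofReal_measureReal (measure_ne_top ν _)]
    refine ENNReal.ofReal_le_ofReal ?_
    rw [measureReal_compl hSm, hν]
    linarith
  have hhi : S ⊆ upperBracket ν ((m + 1) * c / M) := by
    refine Set.subset_sUnion_of_mem ⟨hS, ?_⟩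
    rw [← ofReal_measureReal (measure_ne_top ν _)]
    exact ENNReal.ofReal_le_ofReal hm'
  refine ⟨hlo, hhi, ?_⟩
  rw [measureReal_sdiff (hlo.trans hhi) (measurableSet_lowerBracket _ _)]
  have h3 : ν.real (upperBracket ν ((m + 1) * c / M)) ≤ (m + 1) * c / M :=
    ENNReal.toReal_le_of_le_ofReal (hv0.trans hm') (measure_sUnion_isLowerSet_le ν _)
  have h4 : ν.real (lowerBracket ν (c - m * c / M))ᶜ ≤ c - m * c / M := by
    rw [lowerBracket, compl_compl]
    exact ENNReal.toReal_le_of_le_ofReal (by linarith) (measure_sUnion_isUpperSet_le ν _)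
  rw [measureReal_compl (measurableSet_lowerBracket _ _), hν] at h4
  have : (m + 1) * c / M = m * c / M + c / M := by ring
  linarith

/-! ### Brackets for boxes, one coordinate at a time -/

variable {d n : ℕ}

/-- The records whose coordinates lie in the sets `U i` and not in the sets `L i`. -/
def cutBox (L U : Fin d → Set I) : Set (Fin d → I) := {z | ∀ i, z i ∈ U i ∧ z i ∉ L i}

lemma measurableSet_cutBox {L U : Fin d → Set I} (hL : ∀ i, MeasurableSet (L i))
    (hU : ∀ i, MeasurableSet (U i)) : MeasurableSet (cutBox L U) := by
  have : cutBox L U = ⋂ i, (fun z : Fin d → I => z i) ⁻¹' (U i \ L i) := by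
    ext z
    simp [cutBox]
  rw [this]
  exact MeasurableSet.iInter fun i => measurable_pi_apply i ((hU i).diff (hL i))

/-- The sum of the laws of the `i`-th coordinates. -/
noncomputable def coordMeasure (χ : Fin n → Measure (Fin d → I)) (i : Fin d) : Measure I :=
  ∑ r, (χ r).map fun z => z i

instance (χ : Fin n → Measure (Fin d → I)) [∀ r, IsProbabilityMeasure (χ r)] (i : Fin d) :
    IsFiniteMeasure (coordMeasure χ i) := by
  unfold coordMeasure
  infer_instance

/-- Only expected counts matter for the brackets, so records with different laws are handled through
one measure of total mass `n` per coordinate. -/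
lemma coordMeasure_real (χ : Fin n → Measure (Fin d → I)) [∀ r, IsProbabilityMeasure (χ r)]
    (i : Fin d) {S : Set I} (hS : MeasurableSet S) :
    (coordMeasure χ i).real S = mass χ ((fun z => z i) ⁻¹' S) := by
  rw [coordMeasure, mass, measureReal_def, Measure.finsetSum_apply,
    ENNReal.toReal_sum fun r _ => measure_ne_top _ _]
  refine Finset.sum_congr rfl fun r _ => ?_
  rw [Measure.map_apply (measurable_pi_apply i) hS, measureReal_def]

lemma mass_iUnion_le (χ : Fin n → Measure (Fin d → I)) [∀ r, IsProbabilityMeasure (χ r)]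
    (A : Fin d → Set (Fin d → I)) : mass χ (⋃ i, A i) ≤ ∑ i, mass χ (A i) := by
  simp only [mass]
  rw [Finset.sum_comm]
  exact Finset.sum_le_sum fun r _ => measureReal_iUnion_fintype_le _

/-- Boxes with sides that are differences of initial segments have small brackets. -/
theorem exists_cutBox_brackets (χ : Fin n → Measure (Fin d → I))
    [∀ r, IsProbabilityMeasure (χ r)] (hn : 1 ≤ n) (k : ℕ) :
    ∃ B : Finset (Set (Fin d → I) × Set (Fin d → I)),
      (∀ b ∈ B, MeasurableSet b.1 ∧ MeasurableSet b.2) ∧ B.card ≤ 2 ^ ((2 * d + 1) * (k + 1)) ∧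
      ∀ L U : Fin d → Set I, (∀ i, IsLowerSet (L i)) → (∀ i, IsLowerSet (U i)) →
        ∃ b ∈ B, b.1 ⊆ cutBox L U ∧ cutBox L U ⊆ b.2 ∧
          mass χ (b.2 \ b.1) ≤ (2 * d + 1 : ℕ) * n / 2 ^ k := by
  classical
  have hn' : (0 : ℝ) < n := by exact_mod_cast hn
  have htot : ∀ i, (coordMeasure χ i).real Set.univ = n := fun i => by
    rw [coordMeasure_real χ i MeasurableSet.univ]
    simp [mass]
  let lo : Fin d → Fin (2 ^ k + 1) → Set I := fun i m =>
    lowerBracket (coordMeasure χ i) (n - m * n / (2 ^ k : ℕ))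
  let hi : Fin d → Fin (2 ^ k + 1) → Set I := fun i m =>
    upperBracket (coordMeasure χ i) ((m + 1) * n / (2 ^ k : ℕ))
  -- The inner box removes the larger bracket end of `L` and keeps the smaller end of `U`; the outer
  -- box does the opposite.
  let e : (Fin d → Fin (2 ^ k + 1)) × (Fin d → Fin (2 ^ k + 1)) →
      Set (Fin d → I) × Set (Fin d → I) := fun m =>
    (cutBox (fun i => hi i (m.1 i)) fun i => lo i (m.2 i),
      cutBox (fun i => lo i (m.1 i)) fun i => hi i (m.2 i))
  have hlo : ∀ i m, MeasurableSet (lo i m) := fun i m => measurableSet_lowerBracket _ _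
  have hhi : ∀ i m, MeasurableSet (hi i m) := fun i m => measurableSet_upperBracket _ _
  refine ⟨Finset.univ.image e, ?_, ?_, ?_⟩
  · intro b hb
    obtain ⟨m, -, rfl⟩ := Finset.mem_image.1 hb
    exact ⟨measurableSet_cutBox (fun i => hhi _ _) fun i => hlo _ _,
      measurableSet_cutBox (fun i => hlo _ _) fun i => hhi _ _⟩
  · refine Finset.card_image_le.trans ?_
    have h1 : 2 ^ k + 1 ≤ 2 ^ (k + 1) := by
      have := Nat.one_le_two_pow (n := k)
      rw [pow_succ]
      omega
    simp only [Finset.card_univ, Fintype.card_prod, Fintype.card_fun, Fintype.card_fin]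
    calc (2 ^ k + 1) ^ d * (2 ^ k + 1) ^ d
        ≤ (2 ^ (k + 1)) ^ d * (2 ^ (k + 1)) ^ d := by gcongr
      _ = 2 ^ (2 * d * (k + 1)) := by ring
      -- The exponent `2 d` is weakened to `2 d + 1` because the chaining bound needs a positive
      -- dimension, also for `d = 0`.
      _ ≤ _ := Nat.pow_le_pow_right (by norm_num) (Nat.mul_le_mul_right _ (by omega))
  · intro L U hL hU
    choose m hm using fun i =>
      exists_bracket (coordMeasure χ i) hn' (htot i) (Nat.one_le_two_pow (n := k)) (hL i)
    choose m' hm' using fun i =>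
      exists_bracket (coordMeasure χ i) hn' (htot i) (Nat.one_le_two_pow (n := k)) (hU i)
    refine ⟨e (m, m'), Finset.mem_image_of_mem e (Finset.mem_univ _), ?_, ?_, ?_⟩
    · exact fun z hz i => ⟨(hm' i).1 (hz i).1, fun h => (hz i).2 ((hm i).2.1 h)⟩
    · exact fun z hz i => ⟨(hm' i).2.1 (hz i).1, fun h => (hz i).2 ((hm i).1 h)⟩
    · have hsub : (e (m, m')).2 \ (e (m, m')).1 ⊆
          ⋃ i, ((fun z => z i) ⁻¹' (hi i (m i) \ lo i (m i)) ∪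
            (fun z => z i) ⁻¹' (hi i (m' i) \ lo i (m' i))) := by
        rintro z ⟨h1, h2⟩
        simp only [e, cutBox, Set.mem_ofPred_eq, not_forall] at h2
        obtain ⟨i, hi'⟩ := h2
        refine Set.mem_iUnion.2 ⟨i, ?_⟩
        by_cases h3 : z i ∈ lo i (m' i)
        · exact .inl ⟨by_contra fun h => hi' ⟨h3, h⟩, (h1 i).2⟩
        · exact .inr ⟨(h1 i).1, h3⟩
      have hcell : ∀ i, mass χ ((fun z => z i) ⁻¹' (hi i (m i) \ lo i (m i)) ∪
            (fun z => z i) ⁻¹' (hi i (m' i) \ lo i (m' i))) ≤ 2 * (n / 2 ^ k) := fun i => by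
        refine (mass_union_le χ _ _).trans ?_
        rw [← coordMeasure_real χ i ((hhi _ _).diff (hlo _ _)),
          ← coordMeasure_real χ i ((hhi _ _).diff (hlo _ _))]
        have h1 := (hm i).2.2
        have h2 := (hm' i).2.2
        simp only [lo, hi]
        push_cast at h1 h2 ⊢
        linarith
      refine (mass_mono χ hsub).trans ((mass_iUnion_le χ _).trans
        ((Finset.sum_le_sum fun i _ => hcell i).trans ?_))
      have : (0 : ℝ) ≤ n / 2 ^ k := by positivity
      simp only [Finset.sum_const, Finset.card_univ, Fintype.card_fin, nsmul_eq_mul]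
      push_cast
      rw [mul_div_assoc]
      nlinarith

end Brackets

/-! ### Uniform deviations of the operation functions -/

namespace Operation

/-- The records that match a query. -/
def matchSet (op : Operation) (x : op.Query) : Set op.Record := {z | op.Matches x z}

/-- An interval is an initial segment minus another one. For rank nothing is removed; for
cardinality the removed segment is strict, which keeps the box closed. -/
lemma exists_matchSet_eq_cutBox (op : Operation) (x : op.Query) :
    ∃ L U : Fin op.dim → Set I, (∀ i, IsLowerSet (L i)) ∧ (∀ i, IsLowerSet (U i)) ∧
      op.matchSet x = cutBox L U := by
  cases op with
  | rank =>
    refine ⟨fun _ => ∅, fun _ => Set.Iio (x (0 : Fin 1)), fun _ => isLowerSet_empty,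
      fun _ => isLowerSet_Iio _, ?_⟩
    ext z
    simp only [matchSet, cutBox, Matches, Set.mem_ofPred_eq, Set.mem_Iio, Set.mem_empty_iff_false,
      not_false_eq_true, and_true]
    exact (Fin.forall_fin_one (p := fun i : Fin 1 => z i < x (0 : Fin 1))).symm
  | card d =>
    refine ⟨fun i => {z | (z : ℝ) < x (Fin.castAdd d i)},
      fun i => {z | (z : ℝ) ≤ x (Fin.castAdd d i) + x (Fin.natAdd d i)},
      fun i a b hab ha => lt_of_le_of_lt (Subtype.coe_le_coe.2 hab) ha,
      fun i a b hab ha => le_trans (Subtype.coe_le_coe.2 hab) ha, ?_⟩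
    ext z
    simp only [matchSet, cutBox, Matches, Set.mem_ofPred_eq, not_lt]
    exact forall_congr' fun i => and_comm

lemma measurableSet_matchSet (op : Operation) (x : op.Query) :
    MeasurableSet (op.matchSet x) := by
  obtain ⟨L, U, hL, hU, h⟩ := op.exists_matchSet_eq_cutBox x
  rw [h]
  exact measurableSet_cutBox (fun i => (hL i).ordConnected.measurableSet)
    fun i => (hU i).ordConnected.measurableSet

lemma count_eq_sum (op : Operation) {n : ℕ} (D : Fin n → op.Record) (x : op.Query) :
    op.count D x = ∑ i, (op.matchSet x).indicator 1 (D i) := by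
  classical
  rw [count, Nat.card_eq_fintype_card, Fintype.card_subtype, Finset.card_filter]
  push_cast
  exact Finset.sum_congr rfl fun i _ => by simp [Set.indicator_apply, matchSet]

lemma distFn_eq_mass (op : Operation) {n : ℕ} (χ : Fin n → ProbabilityMeasure op.Record)
    (x : op.Query) :
    op.distFn χ x = mass (fun i => (χ i : Measure op.Record)) (op.matchSet x) := by
  have hm := op.measurableSet_matchSet x
  have hmeas : Measurable ((op.matchSet x).indicator (1 : op.Record → ℝ)) :=
    measurable_one.indicator hm
  simp only [distFn, dataLaw, count_eq_sum]
  rw [integral_finsetSum, mass]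
  · refine Finset.sum_congr rfl fun i _ => ?_
    rw [integral_comp_eval (μ := fun i => (χ i : Measure op.Record)) (i := i)
      hmeas.aestronglyMeasurable, integral_indicator_one hm]
  · intro i _
    refine Integrable.of_bound (C := 1)
      (hmeas.comp (measurable_pi_apply i)).aestronglyMeasurable (.of_forall fun D => ?_)
    by_cases h : D i ∈ op.matchSet x <;> simp [h]

lemma count_sub_distFn (op : Operation) {n : ℕ} (χ : Fin n → ProbabilityMeasure op.Record)
    (D : Fin n → op.Record) (x : op.Query) :
    op.count D x - op.distFn χ x =
      empDev (fun i => (χ i : Measure op.Record)) (op.matchSet x) D := by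
  rw [count_eq_sum, distFn_eq_mass, empDev_eq]

/-- For identical laws `f_χ / n` is the function of a single record; this reduces the i.i.d.
statement to the general one. -/
lemma distFn_const (op : Operation) {n : ℕ} (χ : Fin n → ProbabilityMeasure op.Record)
    (ν : ProbabilityMeasure op.Record) (h : ∀ i, χ i = ν) (x : op.Query) :
    op.distFn χ x = n * op.distFn (fun _ : Fin 1 => ν) x := by
  simp [distFn_eq_mass, mass, h]

/-- Sub-Gaussian bound for the uniform deviation of an operation function from its mean. -/
theorem measure_exists_le_abs_count_sub (op : Operation) {n : ℕ} (hn : 1 ≤ n)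
    (χ : Fin n → ProbabilityMeasure op.Record) {s : ℝ} (hs : 0 < s) :
    op.dataLaw χ {D | ∃ x, s * √n ≤ |op.count D x - op.distFn χ x|} ≤
      ENNReal.ofReal (4 * Real.exp (32 * (2 * op.dim + 1 : ℕ)) *
        Real.exp (-(s ^ 2 / (3200 * (2 * op.dim + 1 : ℕ))))) := by
  choose B hB1 hB2 hB3 using
    exists_cutBox_brackets (fun i => (χ i : Measure op.Record)) hn
  have key := measure_exists_le_abs_empDev (fun i => (χ i : Measure op.Record)) hn
    (d := 2 * op.dim + 1) (by omega) (Set.range op.matchSet) B hB1 hB2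
    (by
      rintro S ⟨x, rfl⟩ k
      obtain ⟨L, U, hL, hU, h⟩ := op.exists_matchSet_eq_cutBox x
      rw [h]
      exact hB3 k L U hL hU) hs
  simp only [Set.exists_range_iff, ← count_sub_distFn] at key
  rw [dataLaw, ← ofReal_measureReal (measure_ne_top _ _)]
  exact ENNReal.ofReal_le_ofReal key

end Operation

/-! ### Program transformations -/

/-- Rename labels and registers, with replacements for `query` and `halt`. -/
def Instr.map {L R L' R' : Type} {w k k' : ℕ} (i : Instr L R w k) (f : L → L')
    (g : R → R') (onQuery onHalt : Instr L' R' w k') : Instr L' R' w k' :=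
  match i with
  | .const dst a l => .const (g dst) a (f l)
  | .add dst a b l => .add (g dst) (g a) (g b) (f l)
  | .sub dst a b l => .sub (g dst) (g a) (g b) (f l)
  | .mul dst a b l => .mul (g dst) (g a) (g b) (f l)
  | .div dst a b l => .div (g dst) (g a) (g b) (f l)
  | .floor dst a l => .floor (g dst) (g a) (f l)
  | .branchLt a b yes no => .branchLt (g a) (g b) (f yes) (f no)
  | .load dst addr l => .load (g dst) (g addr) (f l)
  | .store addr src l => .store (g addr) (g src) (f l)
  | .size dst l => .size (g dst) (f l)
  | .input dst row col l => .input (g dst) (g row) col (f l)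
  | .query _ _ _ => onQuery
  | .halt => onHalt

namespace Program

variable {w k k' : ℕ}

/-- The program gets from `c` to `c'` in `m` steps. -/
def StepsTo (P : Program w k) (E : Env w k) (m : ℕ) (c c' : Config P.L P.R) : Prop :=
  (fun o => Option.bind o (P.step E))^[m] (some c) = some c'

lemma StepsTo.refl (P : Program w k) (E : Env w k) (c : Config P.L P.R) : P.StepsTo E 0 c c := rfl

lemma StepsTo.trans {P : Program w k} {E : Env w k} {m m' : ℕ} {c c' c'' : Config P.L P.R}
    (h : P.StepsTo E m c c') (h' : P.StepsTo E m' c' c'') : P.StepsTo E (m + m') c c'' := by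
  rw [StepsTo, add_comm, Function.iterate_add_apply, h, h']

lemma StepsTo.cons {P : Program w k} {E : Env w k} {m : ℕ} {c c' c'' : Config P.L P.R}
    (h : P.step E c = some c') (h' : P.StepsTo E m c' c'') : P.StepsTo E (m + 1) c c'' := by
  rw [StepsTo, Function.iterate_succ_apply]
  exact (congrArg _ h).trans h'

lemma StepsTo.single {P : Program w k} {E : Env w k} {c c' : Config P.L P.R}
    (h : P.step E c = some c') : P.StepsTo E 1 c c' := Program.StepsTo.cons h (StepsTo.refl P E c')

lemma stepsTo_succ {P : Program w k} {E : Env w k} {m : ℕ} {c c'' : Config P.L P.R}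
    (h : P.StepsTo E (m + 1) c c'') : ∃ c', P.StepsTo E m c c' ∧ P.step E c' = some c'' := by
  rw [StepsTo, Function.iterate_succ_apply'] at h
  exact Option.bind_eq_some_iff.1 h

/-- The configuration `c'` represents `c`, up to renaming; there may be further registers. -/
structure Simulates {L R L' R' : Type} (f : L → L') (g : R → R') (c : Config L R)
    (c' : Config L' R') : Prop where
  label : c'.label = f c.label
  reg : ∀ r, c'.reg (g r) = c.reg r
  mem : c'.mem = c.mem

open Classical in
lemma simulates_update {L R L' R' : Type} {f : L → L'} {g : R → R'} (hg : Function.Injective g)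
    {c : Config L R} {c' : Config L' R'} (h : Simulates f g c c') (l : L) (dst : R) (y : ℝ)
    (μ : ℕ → ℝ) : Simulates f g ⟨l, Function.update c.reg dst y, μ⟩
      ⟨f l, Function.update c'.reg (g dst) y, μ⟩ :=
  ⟨rfl, fun r => by simp [Function.update_apply, hg.eq_iff, h.reg], rfl⟩

/-- Apart from `query` and `halt`, an instruction sees only registers, memory and the input, all of
which correspond; the two oracles may differ. -/
lemma step_map {P : Program w k} {Q : Program w k'} {E : Env w k} {E' : Env w k'}
    (hsize : E'.size = E.size) (hinput : E'.input = E.input) {f : P.L → Q.L} {g : P.R → Q.R}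
    (hg : Function.Injective g) {onQuery onHalt : Instr Q.L Q.R w k'} {c c₁ : Config P.L P.R}
    {c' : Config Q.L Q.R} (hcode : Q.code (f c.label) = (P.code c.label).map f g onQuery onHalt)
    (hq : ∀ dst args l, P.code c.label ≠ .query dst args l) (hstep : P.step E c = some c₁)
    (h : Simulates f g c c') : ∃ c₁', Q.step E' c' = some c₁' ∧ Simulates f g c₁ c₁' := by
  have hl := h.label
  have hr := h.reg
  have hm := h.mem
  rw [← hl] at hcode
  simp only [step] at hstep ⊢
  rw [hcode]
  cases hi : P.code c.label with
  | query dst args l => exact absurd hi (hq dst args l)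
  | halt => simp [hi] at hstep
  | branchLt a b yes no =>
    simp only [hi, Option.some.injEq] at hstep
    subst hstep
    refine ⟨_, rfl, ?_, hr, hm⟩
    simp only [hr]
    split_ifs <;> rfl
  | store addr src l =>
    simp only [hi, Option.some.injEq] at hstep
    subst hstep
    exact ⟨_, rfl, rfl, hr, by simp only [hr, hm]⟩
  | _ =>
    simp only [hi, Option.some.injEq] at hstep
    subst hstep
    refine ⟨_, rfl, ?_⟩
    simp only [hr, hm, hsize, hinput]
    exact simulates_update hg h _ _ _ _

lemma stepsTo_of_simulation {P : Program w k} {Q : Program w k'} {E : Env w k} {E' : Env w k'}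
    {f : P.L → Q.L} {g : P.R → Q.R} {N : ℕ}
    (hsim : ∀ c c₁ c', P.step E c = some c₁ → Simulates f g c c' →
      ∃ m ≤ N, ∃ c₁', Q.StepsTo E' m c' c₁' ∧ Simulates f g c₁ c₁')
    {s : ℕ} {c c₁ : Config P.L P.R} {c' : Config Q.L Q.R} (hs : P.StepsTo E s c c₁)
    (h : Simulates f g c c') :
    ∃ m ≤ N * s, ∃ c₁', Q.StepsTo E' m c' c₁' ∧ Simulates f g c₁ c₁' := by
  induction s generalizing c₁ with
  | zero =>
    obtain rfl : c = c₁ := Option.some.inj hs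
    exact ⟨0, Nat.zero_le _, c', StepsTo.refl _ _ _, h⟩
  | succ s ih =>
    obtain ⟨c₂, h₂, hstep⟩ := stepsTo_succ hs
    obtain ⟨m, hm, c₂', hs₂, hc₂⟩ := ih h₂
    obtain ⟨m', hm', c₃', hs₃, hc₃⟩ := hsim c₂ c₁ c₂' hstep hc₂
    exact ⟨m + m', by rw [Nat.mul_succ]; omega, c₃', hs₂.trans hs₃, hc₃⟩

/-! ### Rescaling the output of a program -/

/-- Run `P` and multiply the result by `a`. -/
noncomputable def scale (P : Program w k) (a : ℝ) : Program w k where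
  L := P.L ⊕ Fin 2
  R := P.R ⊕ Unit
  finL := by have := P.finL; infer_instance
  finR := by have := P.finR; infer_instance
  start := .inl P.start
  out := .inl P.out
  code
    | .inl l => (P.code l).map .inl .inl .halt (.const (.inr ()) a (.inr 0))
    | .inr 0 => .mul (.inl P.out) (.inl P.out) (.inr ()) (.inr 1)
    | .inr 1 => .halt

lemma size_scale (P : Program w k) (a : ℝ) : (P.scale a).size = P.size + 3 := by
  have := P.finL
  have := P.finR
  have h1 : Nat.card (P.L ⊕ Fin 2) = Nat.card P.L + 2 := by simp [Nat.card_sum]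
  have h2 : Nat.card (P.R ⊕ Unit) = Nat.card P.R + 1 := by simp [Nat.card_sum]
  simp only [size, scale]
  omega

/-- A start label and an output register always exist; this lets a constant increase in size be
absorbed into a factor. -/
lemma two_le_size (P : Program w k) : 2 ≤ P.size := by
  have h1 : 0 < Nat.card P.L := Nat.card_pos_iff.2 ⟨⟨P.start⟩, P.finL⟩
  have h2 : 0 < Nat.card P.R := Nat.card_pos_iff.2 ⟨⟨P.out⟩, P.finR⟩
  rw [size]
  omega

open Classical in
lemma Evaluates.scale {P : Program k 0} {p : List ℝ} {x : Fin k → I} {t : ℕ} {y : ℝ}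
    (h : P.Evaluates p x t y) (a : ℝ) : ∃ t' ≤ t + 2, (P.scale a).Evaluates p x t' (y * a) := by
  obtain ⟨c, ⟨s, rfl, hs, hhalt⟩, hy⟩ := h
  set E : Env k 0 := recordsEnv (fun _ : Fin 1 => x) noOracle
  obtain ⟨m, hm, c', hsteps, hsim⟩ := stepsTo_of_simulation (P := P) (Q := P.scale a) (E := E)
    (E' := E) (f := Sum.inl) (g := Sum.inl) (N := 1)
    (fun c c₁ c' hstep hc => by
      obtain ⟨c₁', h1, h2⟩ := step_map (Q := P.scale a) (E' := E) rfl rfl Sum.inl_injective rfl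
        -- A query under `noOracle` has no successor, so a halting run never meets one, and its
        -- replacement by `halt` is harmless.
        (fun dst args l hq => by simp [step, hq, E, recordsEnv, noOracle] at hstep) hstep hc
      exact ⟨1, le_rfl, c₁', StepsTo.single h1, h2⟩)
    (c' := ⟨(P.scale a).start, 0, fun i => p.getD i 0⟩) hs ⟨rfl, fun _ => rfl, rfl⟩
  let rO : (P.scale a).R := Sum.inl P.out
  let rA : (P.scale a).R := Sum.inr ()
  have hne : rO ≠ rA := Sum.inl_ne_inr
  let c₁ : Config (P.scale a).L (P.scale a).R :=
    ⟨.inr 0, Function.update c'.reg rA a, c'.mem⟩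
  let c₂ : Config (P.scale a).L (P.scale a).R :=
    ⟨.inr 1, Function.update c₁.reg rO (c₁.reg rO * c₁.reg rA), c'.mem⟩
  have h1 : (P.scale a).step E c' = some c₁ := by
    have : (P.scale a).code c'.label = .const (.inr ()) a (.inr 0) := by
      rw [hsim.label]
      change (P.code c.label).map _ _ _ _ = _
      rw [hhalt]
      rfl
    simp only [step, this]
    rfl
  have h2 : (P.scale a).step E c₁ = some c₂ := rfl
  refine ⟨m + 2 + 1, by omega, c₂, ⟨m + 2, rfl,
    hsteps.trans ((StepsTo.single h2).cons h1), rfl⟩, ?_⟩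
  have e1 : c₁.reg rO = y := by
    rw [← hy, ← hsim.reg]
    exact Function.update_of_ne hne _ _
  have e2 : c₁.reg rA = a := by simp only [c₁, Function.update_self]
  change c₂.reg rO = _
  simp only [c₂, Function.update_self, e1, e2]

end Program

/-! ### Answering queries by a scan of the records -/

/-- The labels of the scan: the loop, and up to four instructions for every column. -/
abbrev ScanLabel (d : ℕ) : Type := Fin 7 ⊕ Fin d × Fin 4

/-- The label at which the test of column `j` starts; after the last column the record counts. -/
def testLabel (d j : ℕ) : ScanLabel d := if h : j < d then .inr (⟨j, h⟩, 0) else .inl 4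

/-- The instructions that test column `j` of the current record. -/
def testCode {L R : Type} : (op : Operation) → (e : ScanLabel op.dim → L) →
    (args : Fin op.arity → R) → (aux : Fin 6 → R) → Fin op.dim → Fin 4 → Instr L R op.dim 0
  | .rank, e, _, aux, j, 0 => .input (aux 4) (aux 0) j (e (.inr (j, 1)))
  | .rank, e, args, aux, j, 1 => .branchLt (aux 4) (args (0 : Fin 1)) (e (testLabel 1 (j.val + 1)))
      (e (.inl 5))
  -- Rank uses two of the four labels per column; the others are never reached.
  | .rank, _, _, _, _, _ => .halt
  | .card _, e, _, aux, j, 0 => .input (aux 4) (aux 0) j (e (.inr (j, 1)))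
  | .card d, e, args, aux, j, 1 =>
      .branchLt (aux 4) (args (Fin.castAdd d j)) (e (.inl 5)) (e (.inr (j, 2)))
  | .card d, e, args, aux, j, 2 =>
      .add (aux 5) (args (Fin.castAdd d j)) (args (Fin.natAdd d j)) (e (.inr (j, 3)))
  | .card d, e, _, aux, j, 3 =>
      .branchLt (aux 5) (aux 4) (e (.inl 5)) (e (testLabel d (j.val + 1)))

/-- A loop over the records that writes the fraction of those that match `args` into `dst`. The
auxiliary registers hold the row, the count, `1`, the number of records, an entry, and the end of an
interval. The row has been set to `0` before. -/
def scanCode {L R : Type} (op : Operation) (e : ScanLabel op.dim → L) (args : Fin op.arity → R)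
    (aux : Fin 6 → R) (dst : R) (exit : L) : ScanLabel op.dim → Instr L R op.dim 0
  | .inl 0 => .const (aux 1) 0 (e (.inl 1))
  | .inl 1 => .const (aux 2) 1 (e (.inl 2))
  | .inl 2 => .size (aux 3) (e (.inl 3))
  | .inl 3 => .branchLt (aux 0) (aux 3) (e (testLabel op.dim 0)) (e (.inl 6))
  | .inl 4 => .add (aux 1) (aux 1) (aux 2) (e (.inl 5))
  | .inl 5 => .add (aux 0) (aux 0) (aux 2) (e (.inl 3))
  | .inl 6 => .div dst (aux 1) (aux 3) exit
  | .inr (j, a) => testCode op e args aux j a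

section Scan

variable {n : ℕ}

lemma recordsEnv_input {w k : ℕ} (D : Fin n → Fin w → I) (o : (Fin k → ℝ) → Option ℝ) (i : Fin n)
    (j : Fin w) : (recordsEnv D o).input ⌊((i : ℕ) : ℝ)⌋₊ j = D i j := by
  simp [recordsEnv]

open Classical in
lemma stepsTo_test_rank {Q : Program Operation.rank.dim 0} (D : Fin n → Operation.rank.Record)
    {e : ScanLabel Operation.rank.dim → Q.L} {args : Fin Operation.rank.arity → Q.R}
    {aux : Fin 6 → Q.R}
    (hcode : ∀ j a, Q.code (e (.inr (j, a))) = testCode .rank e args aux j a)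
    (hargs : ∀ j a, args j ≠ aux a) (x : Operation.rank.Query) (i : Fin n)
    (c : Config Q.L Q.R) (hl : c.label = e (testLabel Operation.rank.dim 0))
    (hx : ∀ j, c.reg (args j) = x j) (hi : c.reg (aux 0) = (i : ℕ)) :
    ∃ m ≤ 4 * Operation.rank.dim, ∃ c', Q.StepsTo (recordsEnv D noOracle) m c c' ∧
      c'.mem = c.mem ∧ (∀ r, r ≠ aux 4 → r ≠ aux 5 → c'.reg r = c.reg r) ∧
      c'.label = e (if Operation.rank.Matches x (D i) then .inl 4 else .inl 5) := by
  have hc0 : Q.code c.label = .input (aux 4) (aux 0) (0 : Fin 1) (e (.inr ((0 : Fin 1), 1))) := by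
    rw [hl]
    exact hcode (0 : Fin 1) 0
  let z : ℝ := D i (0 : Fin 1)
  let c₁ : Config Q.L Q.R :=
    ⟨e (.inr ((0 : Fin 1), 1)), Function.update c.reg (aux 4) z, c.mem⟩
  have h1 : Q.step (recordsEnv D noOracle) c = some c₁ := by
    simp only [Program.step, hc0, hi]
    rw [recordsEnv_input D noOracle i (0 : Fin 1)]
  have hc1 : Q.code c₁.label = .branchLt (aux 4) (args (0 : Fin 1)) (e (.inl 4)) (e (.inl 5)) :=
    hcode (0 : Fin 1) 1
  have hx1 : c₁.reg (args (0 : Fin 1)) = x (0 : Fin 1) :=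
    (Function.update_of_ne (hargs _ _) _ _).trans (hx _)
  have hz1 : c₁.reg (aux 4) = z := by simp only [c₁, Function.update_self]
  refine ⟨2, by simp [Operation.dim],
    ⟨e (if Operation.rank.Matches x (D i) then .inl 4 else .inl 5), c₁.reg, c.mem⟩,
    Program.StepsTo.cons h1 (Program.StepsTo.single ?_), rfl,
    fun r h4 _ => Function.update_of_ne h4 _ _, rfl⟩
  simp only [Program.step, hc1, hx1, hz1]
  by_cases h : z < x (0 : Fin 1)
  · rw [if_pos h, if_pos (show Operation.rank.Matches x (D i) from h)]
  · rw [if_neg h, if_neg (show ¬ Operation.rank.Matches x (D i) from h)]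

open Classical in
-- Induction on the number `l` of columns still to test; the claim concerns only the columns from
-- `j` on, since the earlier ones have passed.
lemma stepsTo_test_card {d : ℕ} {Q : Program (Operation.card d).dim 0}
    (D : Fin n → (Operation.card d).Record)
    {e : ScanLabel (Operation.card d).dim → Q.L} {args : Fin (Operation.card d).arity → Q.R}
    {aux : Fin 6 → Q.R} (haux : Function.Injective aux)
    (hcode : ∀ j a, Q.code (e (.inr (j, a))) = testCode (.card d) e args aux j a)
    (hargs : ∀ j a, args j ≠ aux a) (x : (Operation.card d).Query) (i : Fin n) (l : ℕ) :
    ∀ j, j + l = d → ∀ c : Config Q.L Q.R, c.label = e (testLabel d j) →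
    (∀ j, c.reg (args j) = x j) → c.reg (aux 0) = (i : ℕ) →
    ∃ m ≤ 4 * l, ∃ c', Q.StepsTo (recordsEnv D noOracle) m c c' ∧
      c'.mem = c.mem ∧ (∀ r, r ≠ aux 4 → r ≠ aux 5 → c'.reg r = c.reg r) ∧
      c'.label = e (if ∀ a : Fin d, j ≤ a → (x (Fin.castAdd d a) : ℝ) ≤ (D i a : ℝ) ∧
        (D i a : ℝ) ≤ (x (Fin.castAdd d a) : ℝ) + (x (Fin.natAdd d a) : ℝ)
        then .inl 4 else .inl 5) := by
  induction l with
  | zero =>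
    intro j hj c hl hx hi
    refine ⟨0, le_rfl, c, Program.StepsTo.refl _ _ _, rfl, fun _ _ _ => rfl, ?_⟩
    rw [if_pos fun a ha => by have := a.2; omega, hl, testLabel, dif_neg (by omega)]
    rfl
  | succ l ih =>
    intro j hj c hl hx hi
    have hjd : j < d := by omega
    let J : Fin d := ⟨j, hjd⟩
    have hc0 : Q.code c.label = .input (aux 4) (aux 0) J (e (.inr (J, 1))) := by
      rw [hl, testLabel, dif_pos hjd]
      exact hcode J 0
    let c₁ : Config Q.L Q.R :=
      ⟨e (.inr (J, 1)), Function.update c.reg (aux 4) (D i J : ℝ), c.mem⟩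
    have h1 : Q.step (recordsEnv D noOracle) c = some c₁ := by
      simp only [Program.step, hc0, hi]
      rw [recordsEnv_input D noOracle i J]
    have hc1 : Q.code c₁.label = .branchLt (aux 4) (args (Fin.castAdd d J)) (e (.inl 5))
        (e (.inr (J, 2))) := hcode J 1
    have hx1 : ∀ a, c₁.reg (args a) = x a := fun a =>
      (Function.update_of_ne (hargs _ _) _ _).trans (hx a)
    have hz1 : c₁.reg (aux 4) = (D i J : ℝ) := by
      simp only [c₁, Function.update_self]
    have hr1 : ∀ r, r ≠ aux 4 → c₁.reg r = c.reg r := fun r h => Function.update_of_ne h _ _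
    have hv : c₁.reg (args (Fin.castAdd d J)) = (x (Fin.castAdd d J) : ℝ) := hx1 _
    have hv' : c₁.reg (args (Fin.natAdd d J)) = (x (Fin.natAdd d J) : ℝ) := hx1 _
    by_cases hlow : (D i J : ℝ) < x (Fin.castAdd d J)
    · refine ⟨2, by omega, ⟨e (.inl 5), c₁.reg, c.mem⟩, Program.StepsTo.cons h1
        (Program.StepsTo.single ?_), rfl, fun r h _ => hr1 r h, ?_⟩
      · simp only [Program.step, hc1, hz1, hv]
        rw [if_pos hlow]
      · rw [if_neg fun h => (h J le_rfl).1.not_gt hlow]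
    let c₂ : Config Q.L Q.R := ⟨e (.inr (J, 2)), c₁.reg, c.mem⟩
    have h2 : Q.step (recordsEnv D noOracle) c₁ = some c₂ := by
      simp only [Program.step, hc1, hz1, hv]
      rw [if_neg hlow]
    have hc2 : Q.code c₂.label = .add (aux 5) (args (Fin.castAdd d J)) (args (Fin.natAdd d J))
        (e (.inr (J, 3))) := hcode J 2
    let c₃ : Config Q.L Q.R := ⟨e (.inr (J, 3)), Function.update c₁.reg (aux 5)
      ((x (Fin.castAdd d J) : ℝ) + x (Fin.natAdd d J)), c.mem⟩
    have h3 : Q.step (recordsEnv D noOracle) c₂ = some c₃ := by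
      simp only [Program.step, hc2, c₂, hv, hv']
      rfl
    have hc3 : Q.code c₃.label = .branchLt (aux 5) (aux 4) (e (.inl 5)) (e (testLabel d (j + 1))) :=
      hcode J 3
    have hs3 : c₃.reg (aux 5) = (x (Fin.castAdd d J) : ℝ) + x (Fin.natAdd d J) := by
      simp only [c₃, Function.update_self]
    have hz3 : c₃.reg (aux 4) = (D i J : ℝ) :=
      (Function.update_of_ne (haux.ne (by decide)) _ _).trans hz1
    have hr3 : ∀ r, r ≠ aux 4 → r ≠ aux 5 → c₃.reg r = c.reg r := fun r h h' =>
      (Function.update_of_ne h' _ _).trans (hr1 r h)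
    have hsteps : Q.StepsTo (recordsEnv D noOracle) 3 c c₃ :=
      Program.StepsTo.cons h1 (Program.StepsTo.cons h2 (Program.StepsTo.single h3))
    by_cases hhigh : (x (Fin.castAdd d J) : ℝ) + x (Fin.natAdd d J) < D i J
    · refine ⟨3 + 1, by omega, ⟨e (.inl 5), c₃.reg, c.mem⟩, hsteps.trans
        (Program.StepsTo.single ?_), rfl, hr3, ?_⟩
      · simp only [Program.step, hc3, hz3, hs3]
        rw [if_pos hhigh]
      · rw [if_neg fun h => (h J le_rfl).2.not_gt hhigh]
    let c₄ : Config Q.L Q.R := ⟨e (testLabel d (j + 1)), c₃.reg, c.mem⟩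
    have h4 : Q.step (recordsEnv D noOracle) c₃ = some c₄ := by
      simp only [Program.step, hc3, hz3, hs3]
      rw [if_neg hhigh]
    obtain ⟨m, hm, c', hc', hmem, hreg, hlab⟩ := ih (j + 1) (by omega) c₄ rfl
      (fun a => (hr3 _ (hargs _ _) (hargs _ _)).trans (hx a))
      ((hr3 _ (haux.ne (by decide)) (haux.ne (by decide))).trans hi)
    refine ⟨3 + 1 + m, by omega, c', (hsteps.trans (Program.StepsTo.single h4)).trans hc', hmem,
      fun r h h' => (hreg r h h').trans (hr3 r h h'), ?_⟩
    rw [hlab]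
    congr 1
    refine if_congr ⟨fun h a ha => ?_, fun h a ha => h a (by omega)⟩ rfl rfl
    rcases ha.eq_or_lt with heq | hlt
    · obtain rfl : J = a := Fin.ext heq
      exact ⟨not_lt.1 hlow, not_lt.1 hhigh⟩
    · exact h a hlt

open Classical in
lemma stepsTo_test {op : Operation} {Q : Program op.dim 0} (D : Fin n → op.Record)
    {e : ScanLabel op.dim → Q.L} {args : Fin op.arity → Q.R}
    {aux : Fin 6 → Q.R} (haux : Function.Injective aux)
    (hcode : ∀ j a, Q.code (e (.inr (j, a))) = testCode op e args aux j a)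
    (hargs : ∀ j a, args j ≠ aux a) (x : op.Query) (i : Fin n)
    (c : Config Q.L Q.R) (hl : c.label = e (testLabel op.dim 0))
    (hx : ∀ j, c.reg (args j) = x j) (hi : c.reg (aux 0) = (i : ℕ)) :
    ∃ m ≤ 4 * op.dim, ∃ c', Q.StepsTo (recordsEnv D noOracle) m c c' ∧
      c'.mem = c.mem ∧ (∀ r, r ≠ aux 4 → r ≠ aux 5 → c'.reg r = c.reg r) ∧
      c'.label = e (if op.Matches x (D i) then .inl 4 else .inl 5) := by
  cases op with
  | rank => exact stepsTo_test_rank D hcode hargs x i c hl hx hi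
  | card d =>
    obtain ⟨m, hm, c', h1, h2, h3, h4⟩ :=
      stepsTo_test_card D haux hcode hargs x i d 0 (zero_add d) c hl hx hi
    refine ⟨m, hm, c', h1, h2, h3, ?_⟩
    rw [h4]
    simp [Operation.Matches]

end Scan

section ScanLoop

variable {n : ℕ}

open Classical in
/-- Whether the record number `i` matches, as a number. -/
noncomputable def matchInd {op : Operation} (D : Fin n → op.Record) (x : op.Query) (i : ℕ) : ℝ :=
  if h : i < n then (if op.Matches x (D ⟨i, h⟩) then 1 else 0) else 0

lemma sum_matchInd {op : Operation} (D : Fin n → op.Record) (x : op.Query) :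
    ∑ i ∈ Finset.range n, matchInd D x i = op.count D x := by
  classical
  rw [op.count_eq_sum, Finset.sum_range]
  exact Finset.sum_congr rfl fun i _ => by
    simp [matchInd, Set.indicator_apply, Operation.matchSet]

variable {op : Operation} {Q : Program op.dim 0} {D : Fin n → op.Record}
  {e : ScanLabel op.dim → Q.L} {args : Fin op.arity → Q.R} {aux : Fin 6 → Q.R} {dst : Q.R}
  {exit : Q.L} {x : op.Query}

/-- The state at the head of the loop, after `a` records. The configuration `c` is the one before
the scan. -/
structure LoopState (D : Fin n → op.Record) (x : op.Query) (e : ScanLabel op.dim → Q.L)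
    (aux : Fin 6 → Q.R) (c : Config Q.L Q.R) (a : ℕ) (c' : Config Q.L Q.R) : Prop where
  label : c'.label = e (.inl 3)
  row : c'.reg (aux 0) = a
  count : c'.reg (aux 1) = ∑ i ∈ Finset.range a, matchInd D x i
  one : c'.reg (aux 2) = 1
  size : c'.reg (aux 3) = n
  mem : c'.mem = c.mem
  reg : ∀ r, (∀ b, r ≠ aux b) → c'.reg r = c.reg r

open Classical in
lemma exists_loopState_zero (haux : Function.Injective aux)
    (hcode : ∀ l, Q.code (e l) = scanCode op e args aux dst exit l) (c : Config Q.L Q.R)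
    (hl : c.label = e (.inl 0)) (hrow : c.reg (aux 0) = 0) :
    ∃ c', Q.StepsTo (recordsEnv D noOracle) 3 c c' ∧ LoopState D x e aux c 0 c' := by
  let c₁ : Config Q.L Q.R := ⟨e (.inl 1), Function.update c.reg (aux 1) 0, c.mem⟩
  let c₂ : Config Q.L Q.R := ⟨e (.inl 2), Function.update c₁.reg (aux 2) 1, c.mem⟩
  let c₃ : Config Q.L Q.R := ⟨e (.inl 3), Function.update c₂.reg (aux 3) n, c.mem⟩
  have k0 : Q.code c.label = .const (aux 1) 0 (e (.inl 1)) := by rw [hl]; exact hcode (.inl 0)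
  have k1 : Q.code c₁.label = .const (aux 2) 1 (e (.inl 2)) := hcode (.inl 1)
  have k2 : Q.code c₂.label = .size (aux 3) (e (.inl 3)) := hcode (.inl 2)
  have h0 : Q.step (recordsEnv D noOracle) c = some c₁ := by simp only [Program.step, k0]; rfl
  have h1 : Q.step (recordsEnv D noOracle) c₁ = some c₂ := by simp only [Program.step, k1]; rfl
  have h2 : Q.step (recordsEnv D noOracle) c₂ = some c₃ := by simp only [Program.step, k2]; rfl
  refine ⟨c₃, Program.StepsTo.cons h0 (Program.StepsTo.cons h1 (Program.StepsTo.single h2)),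
    rfl, ?_, ?_, ?_, ?_, rfl, ?_⟩
  · simp [c₃, c₂, c₁, haux.eq_iff, hrow]
  · simp [c₃, c₂, c₁, haux.eq_iff]
  · simp [c₃, c₂, c₁, haux.eq_iff]
  · simp [c₃]
  · intro r hr
    simp [c₃, c₂, c₁, hr]

open Classical in
lemma LoopState.next (haux : Function.Injective aux)
    (hcode : ∀ l, Q.code (e l) = scanCode op e args aux dst exit l)
    (hargs : ∀ j a, args j ≠ aux a) {c c' : Config Q.L Q.R} (hx : ∀ j, c.reg (args j) = x j)
    {a : ℕ} (ha : a < n) (h : LoopState D x e aux c a c') :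
    ∃ m ≤ 4 * op.dim + 3, ∃ c'', Q.StepsTo (recordsEnv D noOracle) m c' c'' ∧
      LoopState D x e aux c (a + 1) c'' := by
  have k0 : Q.code c'.label = .branchLt (aux 0) (aux 3) (e (testLabel op.dim 0)) (e (.inl 6)) := by
    rw [h.label]
    exact hcode (.inl 3)
  let c₁ : Config Q.L Q.R := ⟨e (testLabel op.dim 0), c'.reg, c'.mem⟩
  have h0 : Q.step (recordsEnv D noOracle) c' = some c₁ := by
    simp only [Program.step, k0, h.row, h.size]
    rw [if_pos (by exact_mod_cast ha)]
  obtain ⟨m, hm, c₂, hs, hmem, hreg, hlab⟩ := stepsTo_test D haux (fun j b => hcode (.inr (j, b)))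
    hargs x ⟨a, ha⟩ c₁ rfl (fun j => (h.reg _ (hargs j)).trans (hx j)) h.row
  have hreg' : ∀ b, b ≠ 4 → b ≠ 5 → c₂.reg (aux b) = c'.reg (aux b) := fun b h4 h5 =>
    hreg _ (haux.ne h4) (haux.ne h5)
  have hother : ∀ r, (∀ b, r ≠ aux b) → c₂.reg r = c.reg r := fun r hr =>
    (hreg r (hr 4) (hr 5)).trans (h.reg r hr)
  -- A match costs one extra step for the count; otherwise the test has already jumped to the same
  -- label.
  obtain ⟨m', hm', c₃, hs', hlab', hmem', hcount, hreg₃⟩ : ∃ m' ≤ 1, ∃ c₃ : Config Q.L Q.R,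
      Q.StepsTo (recordsEnv D noOracle) m' c₂ c₃ ∧ c₃.label = e (.inl 5) ∧ c₃.mem = c.mem ∧
      c₃.reg (aux 1) = ∑ i ∈ Finset.range (a + 1), matchInd D x i ∧
      ∀ r, r ≠ aux 1 → c₃.reg r = c₂.reg r := by
    by_cases hmatch : op.Matches x (D ⟨a, ha⟩)
    · rw [if_pos hmatch] at hlab
      have k2 : Q.code c₂.label = .add (aux 1) (aux 1) (aux 2) (e (.inl 5)) := by
        rw [hlab]
        exact hcode (.inl 4)
      refine ⟨1, le_rfl, ⟨e (.inl 5), Function.update c₂.reg (aux 1)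
        (c₂.reg (aux 1) + c₂.reg (aux 2)), c₂.mem⟩, Program.StepsTo.single ?_, rfl,
        hmem.trans h.mem, ?_, fun r hr => Function.update_of_ne hr _ _⟩
      · simp only [Program.step, k2]
      · simp only [Function.update_self]
        rw [hreg' 1 (by decide) (by decide),
          hreg' 2 (by decide) (by decide), h.count, h.one, Finset.sum_range_succ]
        simp [matchInd, ha, hmatch]
    · rw [if_neg hmatch] at hlab
      refine ⟨0, zero_le_one, c₂, Program.StepsTo.refl _ _ _, hlab, hmem.trans h.mem, ?_,
        fun _ _ => rfl⟩
      rw [hreg' 1 (by decide) (by decide), h.count, Finset.sum_range_succ]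
      simp [matchInd, hmatch]
  have hreg₃' : ∀ b, b ≠ 1 → b ≠ 4 → b ≠ 5 → c₃.reg (aux b) = c'.reg (aux b) :=
    fun b h1 h4 h5 => (hreg₃ _ (haux.ne h1)).trans (hreg' b h4 h5)
  have k3 : Q.code c₃.label = .add (aux 0) (aux 0) (aux 2) (e (.inl 3)) := by
    rw [hlab']
    exact hcode (.inl 5)
  let c₄ : Config Q.L Q.R := ⟨e (.inl 3), Function.update c₃.reg (aux 0)
    (c₃.reg (aux 0) + c₃.reg (aux 2)), c₃.mem⟩
  have h3 : Q.step (recordsEnv D noOracle) c₃ = some c₄ := by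
    simp only [Program.step, k3]
    rfl
  have hreg₄ : ∀ r, r ≠ aux 0 → c₄.reg r = c₃.reg r := fun r hr => Function.update_of_ne hr _ _
  refine ⟨1 + m + m' + 1, by omega, c₄, ((Program.StepsTo.single h0).trans hs |>.trans hs').trans
    (Program.StepsTo.single h3), rfl, ?_, ?_, ?_, ?_, hmem', ?_⟩
  · simp only [c₄, Function.update_self]
    rw [hreg₃' 0 (by decide) (by decide) (by decide),
      hreg₃' 2 (by decide) (by decide) (by decide), h.row, h.one]
    push_cast
    rfl
  · rw [hreg₄ _ (haux.ne (by decide)), hcount]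
  · rw [hreg₄ _ (haux.ne (by decide)), hreg₃' 2 (by decide) (by decide) (by decide), h.one]
  · rw [hreg₄ _ (haux.ne (by decide)), hreg₃' 3 (by decide) (by decide) (by decide), h.size]
  · intro r hr
    rw [hreg₄ r (hr 0), hreg₃ r (hr 1), hother r hr]

open Classical in
/-- The scan computes the fraction of the records that match the query. -/
lemma stepsTo_scan (haux : Function.Injective aux)
    (hcode : ∀ l, Q.code (e l) = scanCode op e args aux dst exit l)
    (hargs : ∀ j a, args j ≠ aux a) {c : Config Q.L Q.R} (hl : c.label = e (.inl 0))
    (hrow : c.reg (aux 0) = 0) (hx : ∀ j, c.reg (args j) = x j) :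
    ∃ m ≤ (4 * op.dim + 3) * n + 5, ∃ c', Q.StepsTo (recordsEnv D noOracle) m c c' ∧
      c'.label = exit ∧ c'.mem = c.mem ∧ c'.reg dst = op.count D x / n ∧
      ∀ r, r ≠ dst → (∀ a, r ≠ aux a) → c'.reg r = c.reg r := by
  obtain ⟨c₀, hs₀, h₀⟩ := exists_loopState_zero (D := D) (x := x) haux hcode c hl hrow
  have hloop : ∀ a ≤ n, ∃ m ≤ (4 * op.dim + 3) * a, ∃ c',
      Q.StepsTo (recordsEnv D noOracle) m c₀ c' ∧ LoopState D x e aux c a c' := by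
    intro a
    induction a with
    | zero => exact fun _ => ⟨0, Nat.zero_le _, c₀, Program.StepsTo.refl _ _ _, h₀⟩
    | succ a ih =>
      intro ha
      obtain ⟨m, hm, c', hs, hc'⟩ := ih (by omega)
      obtain ⟨m', hm', c'', hs', hc''⟩ := hc'.next haux hcode hargs hx ha
      exact ⟨m + m', by rw [Nat.mul_succ]; omega, c'', hs.trans hs', hc''⟩
  obtain ⟨m, hm, c₁, hs₁, h₁⟩ := hloop n le_rfl
  have k1 : Q.code c₁.label = .branchLt (aux 0) (aux 3) (e (testLabel op.dim 0)) (e (.inl 6)) := by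
    rw [h₁.label]
    exact hcode (.inl 3)
  let c₂ : Config Q.L Q.R := ⟨e (.inl 6), c₁.reg, c₁.mem⟩
  have hs₂ : Q.step (recordsEnv D noOracle) c₁ = some c₂ := by
    simp only [Program.step, k1, h₁.row, h₁.size]
    rw [if_neg (lt_irrefl _)]
  have k2 : Q.code c₂.label = .div dst (aux 1) (aux 3) exit := hcode (.inl 6)
  let c₃ : Config Q.L Q.R := ⟨exit, Function.update c₁.reg dst
    (c₁.reg (aux 1) / c₁.reg (aux 3)), c₁.mem⟩
  have hs₃ : Q.step (recordsEnv D noOracle) c₂ = some c₃ := by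
    simp only [Program.step, k2]
    rfl
  refine ⟨3 + m + 2, by omega, c₃, (hs₀.trans hs₁).trans
    (Program.StepsTo.cons hs₂ (Program.StepsTo.single hs₃)), rfl, h₁.mem, ?_, ?_⟩
  · simp only [c₃, Function.update_self, h₁.count, h₁.size, sum_matchInd]
  · exact fun r hr hr' => (Function.update_of_ne hr _ _).trans (h₁.reg r hr')

end ScanLoop

/-! ### Removing the oracle -/

namespace Program

variable {op : Operation}

/-- Run `P`, and answer its queries by scans of the records. -/
noncomputable def scanQueries (P : Program op.dim op.arity) : Program op.dim 0 where
  L := P.L ⊕ P.L × ScanLabel op.dim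
  R := P.R ⊕ Fin 6
  finL := by have := P.finL; infer_instance
  finR := by have := P.finR; infer_instance
  start := .inl P.start
  out := .inl P.out
  code
    | .inl l => (P.code l).map .inl .inl (.const (.inr 0) 0 (.inr (l, .inl 0))) .halt
    -- Each label has its own copy of the loop, so the place to return to is fixed in the code; the
    -- auxiliary registers are shared.
    | .inr (l, a) =>
      match P.code l with
      | .query dst args next =>
        scanCode op (fun b => .inr (l, b)) (fun j => .inl (args j)) .inr (.inl dst) (.inl next) a
      | _ => .halt

open Classical in
lemma stepsTo_scanQueries (P : Program op.dim op.arity) {n : ℕ} (hn : 1 ≤ n)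
    (D : Fin n → op.Record) {c c₁ : Config P.L P.R}
    {c' : Config P.scanQueries.L P.scanQueries.R} (hstep : P.step (optEnv op D) c = some c₁)
    (h : Simulates Sum.inl Sum.inl c c') :
    ∃ m ≤ (4 * op.dim + 9) * n, ∃ c₁', P.scanQueries.StepsTo (recordsEnv D noOracle) m c' c₁' ∧
      Simulates Sum.inl Sum.inl c₁ c₁' := by
  -- One step resets the row, the scan takes the rest, and `n ≥ 1` absorbs the constant.
  have hN : (4 * op.dim + 3) * n + 6 ≤ (4 * op.dim + 9) * n := by nlinarith
  by_cases hq : ∃ dst args l, P.code c.label = .query dst args l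
  · obtain ⟨dst, args, next, hq⟩ := hq
    simp only [step, hq, optEnv, recordsEnv, Option.map_eq_some_iff] at hstep
    obtain ⟨y, hy, rfl⟩ := hstep
    -- An answered query has its arguments in the cube, so they form a query point `x`.
    rw [oracleOf] at hy
    split_ifs at hy with hv
    obtain rfl := Option.some.inj hy
    let x : op.Query := fun j => ⟨c.reg (args j), hv j⟩
    let rI : P.scanQueries.R := Sum.inr 0
    let lI : P.scanQueries.L := Sum.inr (c.label, .inl 0)
    have k0 : P.scanQueries.code c'.label = .const rI 0 lI := by
      rw [h.label]
      change (P.code c.label).map _ _ _ _ = _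
      rw [hq]
      rfl
    let c₀ : Config P.scanQueries.L P.scanQueries.R := ⟨lI, Function.update c'.reg rI 0, c'.mem⟩
    have hs₀ : P.scanQueries.step (recordsEnv D noOracle) c' = some c₀ := by
      simp only [step, k0]
      rfl
    have hreg₀ : ∀ r : P.R, c₀.reg (Sum.inl r) = c.reg r := fun r => by
      let rL : P.scanQueries.R := Sum.inl r
      have hne : rL ≠ rI := Sum.inl_ne_inr
      exact (Function.update_of_ne hne _ _).trans (h.reg r)
    obtain ⟨m, hm, c₂, hs, hlab, hmem, hdst, hreg⟩ := stepsTo_scan (Q := P.scanQueries) (D := D)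
      (e := fun b => Sum.inr (c.label, b)) (args := fun j => Sum.inl (args j)) (aux := Sum.inr)
      (dst := Sum.inl dst) (exit := Sum.inl next) (x := x) Sum.inr_injective
      (fun l => by
        change (match P.code c.label with
          | .query dst args next => scanCode op (fun b => Sum.inr (c.label, b))
              (fun j => Sum.inl (args j)) Sum.inr (Sum.inl dst) (Sum.inl next) l
          | _ => .halt) = _
        rw [hq]
        rfl)
      (fun _ _ => Sum.inl_ne_inr) (c := c₀) rfl (Function.update_self rI _ _)
      (fun j => hreg₀ (args j))
    refine ⟨m + 1, by omega, c₂, StepsTo.cons hs₀ hs, hlab, fun r => ?_, hmem.trans h.mem⟩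
    by_cases hr : r = dst
    · subst hr
      refine hdst.trans ?_
      simp only [Function.update_self]
      rfl
    · exact ((hreg _ (fun h => hr (Sum.inl_injective h)) fun _ => Sum.inl_ne_inr).trans
        (hreg₀ r)).trans (Function.update_of_ne hr _ _).symm
  · push Not at hq
    obtain ⟨c₁', h1, h2⟩ := step_map (P := P) (Q := P.scanQueries) (E := optEnv op D)
      (E' := recordsEnv D noOracle) (f := Sum.inl) (g := Sum.inl) rfl rfl Sum.inl_injective rfl hq hstep h
    exact ⟨1, by omega, c₁', StepsTo.single h1, h2⟩

lemma OutputsList.scanQueries {P : Program op.dim op.arity} {n : ℕ} (hn : 1 ≤ n)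
    {D : Fin n → op.Record} {t : ℕ} {p : List ℝ} (h : P.OutputsList (optEnv op D) t p) :
    ∃ t' ≤ (4 * op.dim + 9) * n * t,
      P.scanQueries.OutputsList (recordsEnv D noOracle) t' p := by
  obtain ⟨c, ⟨s, rfl, hs, hhalt⟩, hout, hp⟩ := h
  obtain ⟨m, hm, c', hs', hsim⟩ := stepsTo_of_simulation (Q := P.scanQueries)
    (fun c c₁ c' => P.stepsTo_scanQueries hn D) (c' := ⟨P.scanQueries.start, 0, 0⟩) hs
    ⟨rfl, fun _ => rfl, rfl⟩
  refine ⟨m + 1, ?_, c', ⟨m, rfl, hs', ?_⟩, ?_, ?_⟩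
  · have : 1 ≤ (4 * op.dim + 9) * n := by nlinarith
    rw [Nat.mul_succ]
    omega
  · rw [hsim.label]
    change (P.code c.label).map _ _ _ _ = _
    rw [hhalt]
    rfl
  · rw [← hout]
    exact hsim.reg P.out
  · rw [hsim.mem]
    exact hp

end Program

/-! ### Distribution learnability by optimization -/

lemma supDist_le_ofReal_iff {Q : Type*} {f g : Q → ℝ} {r : ℝ} (hr : 0 ≤ r) :
    supDist f g ≤ ENNReal.ofReal r ↔ ∀ x, |f x - g x| ≤ r := by
  simp only [supDist, iSup_le_iff, edist_dist, Real.dist_eq]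
  exact forall_congr' fun x => ENNReal.ofReal_le_ofReal_iff hr

/-- Where the data are close to their expectation, the optimized model is close to it as well. -/
lemma abs_distFn_sub_model_le {op : Operation} {n : ℕ} (hn : 1 ≤ n) {κ κ' : ℝ} (hκ : 0 < κ)
    (hκ' : 0 ≤ κ') {D : Fin n → op.Record} {μ f h' : op.Query → ℝ} {s : ℝ} (hs : 0 ≤ s)
    (hD : ∀ x, |op.count D x - μ x| ≤ s * √n)
    (hf : supDist f (fun x => μ x / n) ≤ ENNReal.ofReal (1 / √n))
    (hopt : supDist h' (fun x => op.count D x / n) ≤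
      ENNReal.ofReal (1 / κ) * supDist f (fun x => op.count D x / n) + ENNReal.ofReal (κ' / √n))
    (x : op.Query) : |μ x - h' x * n| ≤ ((1 + 1 / κ) * s + (1 / κ + κ')) * √n := by
  have hn' : (0 : ℝ) < n := by exact_mod_cast hn
  have hsn : 0 < √(n : ℝ) := Real.sqrt_pos.2 hn'
  have hsq : √(n : ℝ) * √n = n := Real.mul_self_sqrt hn'.le
  have hdiv : ∀ r : ℝ, r / √n * n = r * √n := fun r => by
    calc r / √n * n = r / √n * (√n * √n) := by rw [hsq]
      _ = r * √n := by field_simp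
  -- The representing function is compared with the data through the mean: `1/√n` for the
  -- representation, `s/√n` for the deviation.
  have hfh : supDist f (fun x => op.count D x / n) ≤ ENNReal.ofReal ((1 + s) / √n) := by
    rw [supDist_le_ofReal_iff (by positivity)] at hf ⊢
    intro y
    have h1 : |op.count D y / n - μ y / n| ≤ s / √n := by
      rw [← sub_div, abs_div, abs_of_pos hn', div_le_iff₀ hn', hdiv]
      exact hD y
    have h2 := abs_sub_le (f y) (μ y / n) (op.count D y / n)
    have h3 := hf y
    rw [abs_sub_comm] at h1
    rw [add_div]
    linarith
  have hh : supDist h' (fun x => op.count D x / n) ≤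
      ENNReal.ofReal (((1 / κ) * (1 + s) + κ') / √n) := by
    refine hopt.trans ((add_le_add_left (mul_le_mul_right hfh _) _).trans_eq ?_)
    rw [← ENNReal.ofReal_mul (by positivity), ← ENNReal.ofReal_add (by positivity) (by positivity)]
    congr 1
    ring
  rw [supDist_le_ofReal_iff (by positivity)] at hh
  have h1 : |h' x * n - op.count D x| ≤ ((1 / κ) * (1 + s) + κ') * √n := by
    have e : h' x * n - op.count D x = (h' x - op.count D x / n) * n := by
      field_simp
    rw [e, abs_mul, abs_of_pos hn', ← hdiv]
    exact mul_le_mul_of_nonneg_right (hh x) hn'.le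
  have h2 := hD x
  have h3 := abs_sub_le (μ x) (op.count D x) (h' x * n)
  rw [abs_sub_comm (μ x) (op.count D x), abs_sub_comm (op.count D x) (h' x * n)] at h3
  nlinarith

/-- The tail bound for an optimized model. -/
lemma measure_le_supDist_model {op : Operation} {n : ℕ} (hn : 1 ≤ n) {κ κ' : ℝ} (hκ : 0 < κ)
    (hκ' : 0 ≤ κ') (χ : Fin n → ProbabilityMeasure op.Record) {f : op.Query → ℝ}
    {model : (Fin n → op.Record) → op.Query → ℝ}
    (hf : supDist f (fun x => op.distFn χ x / n) ≤ ENNReal.ofReal (1 / √n))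
    (hopt : ∀ D, supDist (model D) (fun x => op.count D x / n) ≤
      ENNReal.ofReal (1 / κ) * supDist f (fun x => op.count D x / n) + ENNReal.ofReal (κ' / √n))
    {K c : ℝ} (hK : 1 ≤ K) (hc : 0 < c)
    (hdev : ∀ s : ℝ, 0 < s → op.dataLaw χ {D | ∃ x, s * √n ≤ |op.count D x - op.distFn χ x|} ≤
      ENNReal.ofReal (K * Real.exp (-(c * s ^ 2)))) {ε : ℝ} (hε : √n ≤ ε) :
    op.dataLaw χ {D | ENNReal.ofReal ε ≤ supDist (op.distFn χ) (fun x => model D x * n)} ≤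
      ENNReal.ofReal (K * Real.exp (c / (2 * (1 + 1 / κ)) ^ 2 * (2 * (1 / κ + κ')) ^ 2) *
        Real.exp (-(c / (2 * (1 + 1 / κ)) ^ 2) * (ε / √n - 1) ^ 2)) := by
  have hn' : (0 : ℝ) < n := by exact_mod_cast hn
  have hsn : 0 < √(n : ℝ) := Real.sqrt_pos.2 hn'
  set e := ε / √n
  have hε' : ε = e * √n := by simp only [e]; field_simp
  have he : 1 ≤ e := by rwa [le_div_iff₀ hsn, one_mul]
  set a := 2 * (1 + 1 / κ)
  set b := 2 * (1 / κ + κ')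
  have ha : 0 < a := by positivity
  have hb : 0 ≤ b := by positivity
  -- For `e ≤ b` the constant in front makes the bound at least `1`. For `e > b`, the choice `s = e
  -- / a` gives an error of at most `(e + b)/2 · √n`, strictly below `ε`.
  rcases le_or_gt e b with heb | heb
  · have : IsProbabilityMeasure (op.dataLaw χ) := by
      unfold Operation.dataLaw
      infer_instance
    refine prob_le_one.trans ?_
    rw [← ENNReal.ofReal_one]
    refine ENNReal.ofReal_le_ofReal ?_
    rw [mul_assoc, ← Real.exp_add]
    refine one_le_mul_of_one_le_of_one_le hK (Real.one_le_exp ?_)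
    have h1 : (e - 1) ^ 2 ≤ b ^ 2 := by nlinarith
    have h2 : 0 ≤ c / a ^ 2 := by positivity
    nlinarith
  · have hs : 0 < e / a := by positivity
    refine (measure_mono ?_).trans ((hdev (e / a) hs).trans (ENNReal.ofReal_le_ofReal ?_))
    · intro D hD
      by_contra hcon
      simp only [Set.mem_ofPred_eq, not_exists, not_le] at hcon hD
      have hle := abs_distFn_sub_model_le hn hκ hκ' hs.le (fun x => (hcon x).le) hf (hopt D)
      have hval : (1 + 1 / κ) * (e / a) + (1 / κ + κ') = (e + b) / 2 := by
        simp only [a, b]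
        field_simp
      rw [hval] at hle
      have h1 := hD.trans ((supDist_le_ofReal_iff (by positivity)).2 hle)
      rw [ENNReal.ofReal_le_ofReal_iff (by positivity), hε'] at h1
      nlinarith
    · rw [mul_assoc, ← Real.exp_add]
      have h1 : (e - 1) ^ 2 ≤ e ^ 2 := by nlinarith
      have h2 : 0 ≤ c / a ^ 2 := by positivity
      have h3 : c * (e / a) ^ 2 = c / a ^ 2 * e ^ 2 := by
        rw [div_pow]
        ring
      gcongr
      rw [h3]
      nlinarith [mul_nonneg h2 (sq_nonneg b)]

/-- A model class that can represent the means and can be optimized is a learner. -/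
theorem distributionLearnable_of_isOptimizable {op : Operation} {κ κ' : ℝ} (hκ : 0 < κ)
    (hκ' : 0 ≤ κ') {Θ : Type*} [Preorder Θ] {F : ModelClass op Θ} {G : Set (op.Query → ℝ)}
    {α : ℝ → Θ} {A : Θ → Program op.dim op.arity} (hα : F.IsRepresentationComplexity G α)
    (hA : IsOptimizable F A κ κ') {samp : (n : ℕ) → Set (Fin n → ProbabilityMeasure op.Record)}
    (hG : ∀ n, 1 ≤ n → ∀ χ ∈ samp n, (fun x => op.distFn χ x / n) ∈ G) {K c : ℝ} (hK : 1 ≤ K)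
    (hc : 0 < c)
    (hdev : ∀ n, 1 ≤ n → ∀ (χ : Fin n → ProbabilityMeasure op.Record) (s : ℝ), 0 < s →
      op.dataLaw χ {D | ∃ x, s * √n ≤ |op.count D x - op.distFn χ x|} ≤
        ENNReal.ofReal (K * Real.exp (-(c * s ^ 2)))) :
    DistributionLearnable op samp
      (K * Real.exp (c / (2 * (1 + 1 / κ)) ^ 2 * (2 * (1 / κ + κ')) ^ 2))
      (c / (2 * (1 + 1 / κ)) ^ 2)
      (fun n => (4 * op.dim + 9 : ℕ) * F.inferenceTime (α (1 / √n)))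
      (fun n => (4 * op.dim + 9 : ℕ) * F.space (α (1 / √n)))
      (fun n => (4 * op.dim + 9 : ℕ) * optTime A n (α (1 / √n))) := by
  intro n hn
  have hn' : (0 : ℝ) < n := by exact_mod_cast hn
  set ϑ := α (1 / √n)
  -- The choice depends on `D` and `ϑ` only, never on `χ`, so one learner serves all laws.
  choose t p h' hout hrep hopt using fun D => hA n hn D ϑ
  refine ⟨(A ϑ).scanQueries, (F.infer ϑ).scale n, p, fun D x => h' D x * n, ?_, ?_, ?_, ?_⟩
  · intro D
    obtain ⟨t', ht', h⟩ := (hout D).scanQueries hn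
    refine ⟨t', h, ?_⟩
    have h1 : (t D : ℕ∞) ≤ optTime A n ϑ := le_sSup ⟨D, t D, p D, hout D, rfl⟩
    calc (t' : ℕ∞) ≤ (((4 * op.dim + 9) * n * t D : ℕ) : ℕ∞) := by exact_mod_cast ht'
      _ = n * ((4 * op.dim + 9 : ℕ) * (t D : ℕ∞)) := by
        push_cast
        ring
      _ ≤ _ := mul_le_mul' le_rfl (mul_le_mul' le_rfl h1)
  · intro D x
    obtain ⟨t₀, h₀⟩ := (hrep D).2 x
    obtain ⟨t', ht', h⟩ := h₀.scale n
    refine ⟨t', h, ?_⟩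
    have h1 : (t₀ : ℕ∞) ≤ F.inferenceTime ϑ := le_sSup ⟨p D, h' D, x, t₀, hrep D, h₀, rfl⟩
    -- The `halt` is counted as an operation, so the two extra operations fit into the factor.
    have h2 : 1 ≤ t₀ := by
      obtain ⟨_, ⟨s, rfl, -⟩, -⟩ := h₀
      omega
    calc (t' : ℕ∞) ≤ (((4 * op.dim + 9) * t₀ : ℕ) : ℕ∞) := by
          refine Nat.cast_le.2 (ht'.trans ?_)
          nlinarith
      _ = (4 * op.dim + 9 : ℕ) * (t₀ : ℕ∞) := Nat.cast_mul _ _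
      _ ≤ _ := mul_le_mul' le_rfl h1
  · intro D
    have h1 : (((F.infer ϑ).size + (p D).length : ℕ) : ℕ∞) ≤ F.space ϑ :=
      le_sSup ⟨p D, h' D, hrep D, rfl⟩
    have h2 := (F.infer ϑ).two_le_size
    calc ((((F.infer ϑ).scale n).size + (p D).length : ℕ) : ℕ∞)
        ≤ (((4 * op.dim + 9) * ((F.infer ϑ).size + (p D).length) : ℕ) : ℕ∞) := by
          refine Nat.cast_le.2 ?_
          rw [Program.size_scale]
          nlinarith
      _ = (4 * op.dim + 9 : ℕ) * (((F.infer ϑ).size + (p D).length : ℕ) : ℕ∞) := Nat.cast_mul _ _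
      _ ≤ _ := mul_le_mul' le_rfl h1
  · intro χ hχ ε hε
    obtain ⟨f, hf, hfg⟩ := (hα (1 / √n) (by positivity)).1 _ (hG n hn χ hχ)
    exact measure_le_supDist_model hn hκ hκ' χ hfg (fun D => hopt D f hf) hK hc
      (hdev n hn χ) hε

end LearnedDB

theorem mainTheorem2 (op : Operation) :
    ∃ C : ℕ, ∀ κ κ' : ℝ, 0 < κ → κ ≤ 1 → 0 ≤ κ' →
      ∃ κ₁ κ₂ : ℝ, 0 < κ₁ ∧ 0 < κ₂ ∧
        ∀ (Θ : Type*) [Preorder Θ] (F : ModelClass op Θ) (G : Set (op.Query → ℝ)) (α : ℝ → Θ)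
          (A : Θ → Program op.dim op.arity) (𝔛 : Set (ProbabilityMeasure op.Record)),
          F.IsRepresentationComplexity G α →
          IsOptimizable F A κ κ' →
          ((∀ (n : ℕ), 1 ≤ n → ∀ χ ∈ independentFrom 𝔛 n, (fun x => op.distFn χ x / n) ∈ G) →
            DistributionLearnable op (independentFrom 𝔛) κ₁ κ₂
              (fun n => C * F.inferenceTime (α (1 / √n)))
              (fun n => C * F.space (α (1 / √n)))
              (fun n => C * optTime A n (α (1 / √n)))) ∧
          ((∀ ν ∈ 𝔛, op.distFn (fun _ : Fin 1 => ν) ∈ G) →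
            DistributionLearnable op (iidFrom 𝔛) κ₁ κ₂
              (fun n => C * F.inferenceTime (α (1 / √n)))
              (fun n => C * F.space (α (1 / √n)))
              (fun n => C * optTime A n (α (1 / √n)))) := by
  -- `C` is the cost per record of simulating one step of the optimizer; it also covers the constant
  -- overhead of rescaling.
  refine ⟨4 * op.dim + 9, fun κ κ' hκ _ hκ' => ?_⟩
  let d : ℕ := 2 * op.dim + 1
  have hd : (1 : ℝ) ≤ d := by simp [d]
  have hK : 1 ≤ 4 * Real.exp (32 * d) := by
    have := Real.one_le_exp (x := 32 * (d : ℝ)) (by positivity)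
    linarith
  have hc : (0 : ℝ) < 1 / (3200 * d) := by positivity
  have hdev : ∀ n, 1 ≤ n → ∀ (χ : Fin n → ProbabilityMeasure op.Record) (s : ℝ), 0 < s →
      op.dataLaw χ {D | ∃ x, s * √n ≤ |op.count D x - op.distFn χ x|} ≤
        ENNReal.ofReal (4 * Real.exp (32 * d) * Real.exp (-(1 / (3200 * d) * s ^ 2))) :=
    fun n hn χ s hs => by
      rw [one_div_mul_eq_div]
      exact op.measure_exists_le_abs_count_sub hn χ hs
  refine ⟨4 * Real.exp (32 * d) *
      Real.exp (1 / (3200 * d) / (2 * (1 + 1 / κ)) ^ 2 * (2 * (1 / κ + κ')) ^ 2),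
    1 / (3200 * d) / (2 * (1 + 1 / κ)) ^ 2, by positivity, by positivity,
    fun Θ _ F G α A 𝔛 hα hA => ⟨fun hG => ?_, fun hG => ?_⟩⟩
  · exact distributionLearnable_of_isOptimizable hκ hκ' hα hA hG hK hc hdev
  · refine distributionLearnable_of_isOptimizable hκ hκ' hα hA ?_ hK hc hdev
    rintro n hn χ ⟨ν, hν, hχ⟩
    have hn' : (n : ℝ) ≠ 0 := by positivity
    convert hG ν hν using 2 with x
    rw [op.distFn_const χ ν hχ]
    field_simp
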